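/- Wires and boxes diagrams. A diagram is drawn on the plane grid $\mathbb{Z}^2$ from the following devices, through which a single signal travels. *Wires* are directed and may bend; each piece of wire can be used only once. A *union* joins two incoming wires into one outgoing wire. A *cross* lets two wires $1,2$ cross without interaction, but its wire $2$ can be used only after its wire $1$ has been used. A *box* has a state in $\{0,1\}$ and up to five wires, which in clockwise order are $1,2,5,3,4$ (boxes may be rotated but not reflected; some of the wires may be left unconnected): a signal arriving by wire $1$ can pass only if the state is $0$, in which case the state becomes $1$ and the signal leaves by wire $2$; a signal arriving by wire $3$ leaves by wire $4$ if the state is $0$ and by wire $5$ if the state is $1$, without changing the state. The signal is stuck if it has to go on in a way that these rules do not allow. A diagram includes the initial states of its boxes; it is *periodic* if it is invariant under two linearly independent translations of $\mathbb{Z}^2$. Cellular automata. A cellular automaton of radius $1/2$ with finite set of states $A$ and local function $f:A\times A\to A$ maps $x\in A^{\mathbb{Z}}$ to $F(x)\in A^{\mathbb{Z}}$, $F(x)_i=f(x_{i-1},x_i)$. A state $q$ is *quiescent* if $f(q,q)=q$, and $x$ is *finite* if $x_i=q$ for all but finitely many $i$. Simulation. Fix an injective binary code $A\to\{0,1\}^N$,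 points $o_1,\dots,o_N\in\mathbb{Z}^2$ and linearly independent $u,v\in\mathbb{Z}^2$ such that the points $o_k+iu+tv$ ($1\le k\le N$, $i\in\mathbb{Z}$, $t\in\mathbb{N}$) are pairwise different. A diagram with a given starting point of the signal *simulates* the automaton on $x$ with respect to these data if there is a box at each point $o_k+iu+tv$, the signal travels forever without being stuck, and there are moments $0=\tau_0<\tau_1<\tau_2<\cdots$ such that for every $t\ge 0$, from the moment $\tau_t$ on, the state of the box at $o_k+iu+tv$ is the $k$-th bit of the code of $F^t(x)_i$, for all $i\in\mathbb{Z}$ and all $k$. Theorem 1. For every cellular automaton of radius $1/2$ with a quiescent state there are an infinite periodic wires and boxes diagram and data $(N,\text{code},o,u,v)$ as above, with $u$ and $v$ periods of the diagram, such that for every finite initial configuration $x$ the diagram can be modified in a finite part, and the starting point of the signal can be chosen, in such a way that the modified diagram simulates the automaton on $x$. -/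

import Mathlib

/-! ## One-way cellular automata (radius 1/2) -/

namespace RadiusHalfCA

/-- One synchronous step of the radius 1/2 cellular automaton with local function `f`. -/
def step {A : Type*} (f : A → A → A) (x : ℤ → A) : ℤ → A :=
  fun i => f (x (i - 1)) (x i)

/-- The configuration after `t` steps. -/
def evolve {A : Type*} (f : A → A → A) (t : ℕ) (x : ℤ → A) : ℤ → A :=
  (step f)^[t] x

/-- Finite configurations: all but finitely many cells are in the state `q`. -/
def IsFiniteConfig {A : Type*} (q : A) (x : ℤ → A) : Prop :=
  {i : ℤ | x i ≠ q}.Finite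

end RadiusHalfCA

/-! ## Wires and boxes diagrams, drawn on the square grid -/

namespace WiresBoxes

/-- The four headings (compass directions) of the grid. -/
inductive Dir where
  | north | east | south | west
  deriving DecidableEq

/-- Quarter turn clockwise. -/
def Dir.right : Dir → Dir
  | .north => .east
  | .east => .south
  | .south => .west
  | .west => .north

/-- Quarter turn counterclockwise. -/
def Dir.left : Dir → Dir
  | .north => .west
  | .west => .south
  | .south => .east
  | .east => .north

/-- The opposite heading. -/
def Dir.opp : Dir → Dir
  | .north => .south
  | .east => .west
  | .south => .north
  | .west => .east

/-- Cells of the grid. -/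
abbrev Cell : Type := ℤ × ℤ

/-- Unit vector of a heading. -/
def Dir.vec : Dir → Cell
  | .north => (0, 1)
  | .east => (1, 0)
  | .south => (0, -1)
  | .west => (-1, 0)

/-- Content of one grid cell.  All directions attached to wires are *headings of the signal*:
a signal with heading `north` enters a cell through its south side and leaves it through its
north side.

* `wire i o`: a piece of wire, entered with heading `i` and left with heading `o`.
* `union i j o`: two incoming wires, entered with headings `i` and `j`, joined into one outgoing
  wire, left with heading `o`.
* `cross i j`: two straight wires that cross, wire 1 with heading `i` and wire 2 with heading `j`.
* `boxRead u s` and `boxWrite u`: the two halves of a box, which covers two adjacent cells.  The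
  heading `u` points from the reading half to the writing half, and `s` is the initial state.
  For `u = north` (other cases are obtained by rotation), wire 1 arrives at the west side and
  wire 2 departs from the east side of the upper (writing) cell, wire 3 arrives at the south side
  of the lower (reading) cell, wire 4 departs from its west side and wire 5 from its east side; so
  the clockwise order is 1-2-5-3-4.  Wires that are not needed are left unconnected. -/
inductive Tile where
  | blank
  | wire (i o : Dir)
  | union (i j o : Dir)
  | cross (i j : Dir)
  | boxRead (u : Dir) (s : Bool)
  | boxWrite (u : Dir)

/-- The sides of a cell that are used by the wires of a tile are pairwise different. -/
def Tile.WellFormed : Tile → Prop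
  | .blank => True
  | .wire i o => o ≠ i.opp
  | .union i j o => i ≠ j ∧ o ≠ i.opp ∧ o ≠ j.opp
  | .cross i j => j = i.right ∨ j = i.left
  | .boxRead _ _ => True
  | .boxWrite _ => True

/-- A wires and boxes diagram filling the plane. -/
structure Diagram where
  /-- the content of each cell, including the initial states of the boxes -/
  tile : Cell → Tile
  wellFormed : ∀ p, (tile p).WellFormed
  /-- every reading half of a box has its writing half -/
  read_write : ∀ p u s, tile p = .boxRead u s → tile (p + u.vec) = .boxWrite u
  /-- every writing half of a box has its reading half -/
  write_read : ∀ p u, tile p = .boxWrite u → ∃ s, tile (p - u.vec) = .boxRead u s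

/-- `w` is a period of the diagram (of its wires and of the initial states of its boxes). -/
def Diagram.IsPeriod (D : Diagram) (w : Cell) : Prop :=
  ∀ p, D.tile (p + w) = D.tile p

/-- `E` is obtained from `D` by a modification in a finite part. -/
def Diagram.IsFiniteModification (E D : Diagram) : Prop :=
  {p : Cell | E.tile p ≠ D.tile p}.Finite

/-- There is a box whose reading half is the cell `p`. -/
def Diagram.HasBoxAt (D : Diagram) (p : Cell) : Prop :=
  ∃ u s, D.tile p = .boxRead u s

/-- The place of a signal: `(p, h)` means that it is entering the cell `p` with heading `h`. -/
abbrev Port : Type := Cell × Dir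

/-- The current situation of a diagram in which one signal is travelling. -/
structure Config where
  /-- the place of the signal -/
  signal : Port
  /-- the current state of each box, indexed by the reading half of the box
  (irrelevant at all other cells) -/
  state : Cell → Bool
  /-- the pieces of wire that have been used so far -/
  used : Set Port

/-- Initial state of the box with reading half of this content. -/
def Tile.initialState : Tile → Bool
  | .boxRead _ s => s
  | _ => false

/-- The initial situation, with the signal placed at `start`. -/
def Diagram.init (D : Diagram) (start : Port) : Config where
  signal := start
  state := fun p => (D.tile p).initialState
  used := {start}

/-- `Passes D c o s`: in the situation `c`, the device at the place of the signal lets the signal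
pass, the signal leaves the device with heading `o`, and the states of the boxes become `s`. -/
inductive Passes (D : Diagram) (c : Config) : Dir → (Cell → Bool) → Prop
  | wire (i o : Dir) (htile : D.tile c.signal.1 = .wire i o) (hin : c.signal.2 = i) :
      Passes D c o c.state
  | union_fst (i j o : Dir) (htile : D.tile c.signal.1 = .union i j o) (hin : c.signal.2 = i) :
      Passes D c o c.state
  | union_snd (i j o : Dir) (htile : D.tile c.signal.1 = .union i j o) (hin : c.signal.2 = j) :
      Passes D c o c.state
  | cross_fst (i j : Dir) (htile : D.tile c.signal.1 = .cross i j) (hin : c.signal.2 = i) :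
      Passes D c i c.state
  /-- wire 2 of a cross can be used only after its wire 1 -/
  | cross_snd (i j : Dir) (htile : D.tile c.signal.1 = .cross i j) (hin : c.signal.2 = j)
      (hfst : (c.signal.1, i) ∈ c.used) :
      Passes D c j c.state
  /-- from wire 3 to wire 4, if the box is in state 0 -/
  | read_zero (u : Dir) (s : Bool) (htile : D.tile c.signal.1 = .boxRead u s)
      (hin : c.signal.2 = u) (hstate : c.state c.signal.1 = false) :
      Passes D c u.left c.state
  /-- from wire 3 to wire 5, if the box is in state 1 -/
  | read_one (u : Dir) (s : Bool) (htile : D.tile c.signal.1 = .boxRead u s)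
      (hin : c.signal.2 = u) (hstate : c.state c.signal.1 = true) :
      Passes D c u.right c.state
  /-- from wire 1 to wire 2: only possible in state 0, and the box flips to state 1 -/
  | write (u : Dir) (htile : D.tile c.signal.1 = .boxWrite u)
      (hin : c.signal.2 = u.right) (hstate : c.state (c.signal.1 - u.vec) = false) :
      Passes D c u.right (Function.update c.state (c.signal.1 - u.vec) true)

/-- One step of the signal, through one device into the next cell.  A piece of wire can be used
only once: the signal is stuck if the piece that it should use next has been used before. -/
def Step (D : Diagram) (c c' : Config) : Prop :=
  ∃ o s, Passes D c o s ∧ (c.signal.1 + o.vec, o) ∉ c.used ∧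
    c' = { signal := (c.signal.1 + o.vec, o)
           state := s
           used := insert (c.signal.1 + o.vec, o) c.used }

/-- The manner in which space-time diagrams of a cellular automaton with set of states `A` are
represented by the boxes of a diagram: each state is coded by finitely many bits, and bit `k` of
cell `i` at time `t` is the state of the box at `offset k + i • cellShift + t • rowShift`. -/
structure Layout (A : Type*) where
  /-- number of bits per cell of the automaton -/
  bits : ℕ
  code : A → Fin bits → Bool
  code_injective : Function.Injective code
  offset : Fin bits → Cell
  /-- displacement from a cell of the automaton to the next one -/
  cellShift : Cell
  /-- displacement from a row (a configuration of the automaton) to the next one -/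
  rowShift : Cell
  independent : cellShift.1 * rowShift.2 - cellShift.2 * rowShift.1 ≠ 0
  /-- different bits are held by different boxes -/
  distinct : Function.Injective
    (fun x : ℕ × ℤ × Fin bits => offset x.2.2 + x.2.1 • cellShift + x.1 • rowShift)

/-- The place of the box for bit `k` of cell `i` at time `t`. -/
def Layout.boxAt {A : Type*} (L : Layout A) (t : ℕ) (i : ℤ) (k : Fin L.bits) : Cell :=
  L.offset k + i • L.cellShift + t • L.rowShift

/-- The diagram `D`, with the signal starting at `start`, simulates the automaton with local
function `f` on the initial configuration `x`: the signal travels forever without being stuck,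
row 0 of boxes initially holds `x`, and one after the other the rows `t = 1, 2, ...` are
completed (row `t` at the moment `τ t`), row `t` holding from then on the configuration of the
automaton at time `t`. -/
def Simulates {A : Type*} (D : Diagram) (start : Port) (L : Layout A) (f : A → A → A)
    (x : ℤ → A) : Prop :=
  (∀ t i k, D.HasBoxAt (L.boxAt t i k)) ∧
  ∃ ρ : ℕ → Config, ρ 0 = D.init start ∧ (∀ n, Step D (ρ n) (ρ (n + 1))) ∧
    ∃ τ : ℕ → ℕ, τ 0 = 0 ∧ StrictMono τ ∧
      ∀ t n, τ t ≤ n → ∀ i k,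
        (ρ n).state (L.boxAt t i k) = L.code (RadiusHalfCA.evolve f t x i) k

end WiresBoxes

/-! A box is a write-once bit: writing turns it from 0 to 1, nothing resets it, and each wire serves
only once. A computation is therefore spread out in space, every row of bits using fresh boxes
further south. The plane is tiled by layers of windows. A window reads two neighbouring bits of its
layer and fills two boxes of the next one, copying the bits or applying one of the gates (l, l+r),
(l+r, r), (l, lr) over the field with two elements. Consecutive layers are shifted by one column of
bits, so neighbouring pairs of both parities meet in windows.

One signal serves a whole layer: it runs west through the windows, turns, computes on its way back
east, and drops into the next layer. The westward pass is wire 1 of the crosses that guard the wires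
to the boxes, so it is needed even where nothing is computed. The diagram is periodic and cannot
mark the place of turning, so this place is stored in boxes: every `M`-th window has a flag, 1 lets
the signal pass, 0 turns it back, and either way the flag for the next layer is set. In each layer
the signal thus gets one flag further west. In the east it turns in a window of fixed number, which
drifts east by one column per layer. Gates preserve (0,0), so the nonzero bits spread by at most one
column per layer and stay inside the visited range (`Computes.layerWorks`).

That a single window works is a finite computation (`passable_gate`, `passable_turn`,
`passable_start`, `leavesBy_turn`), carried over to the plane by `Local.run_sound`. `LayerWorks.run`
joins windows to a layer and `Computes.exists_run` joins layers to an infinite run.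

It remains to program the gates. Three additions exchange two neighbouring columns, and conjugation
by exchanges brings distant columns together (`programmable_control`). A cell of the automaton
becomes a block of columns, with one bit for each non-quiescent state, so that the quiescent state
is all zeros. As the pair (q, q) is mapped to q, the new bits are polynomials without constant term
in the old bits (`adds_of_quiescent`), and these gates suffice (`exists_program`). The program is
laid out periodically by `windows`; only the bits of the initial configuration and the flags of
layer 0 have to be put in, which is a finite modification. -/

/-! ## Windows

The diagram is assembled from rectangular windows, 32 cells wide and 24 cells high, whose contents
are given by the following tables (rows from north to south, missing entries are blank). -/

namespace WiresBoxes

namespace Glyph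

/-- In the names, letters are headings, incoming before outgoing. A prefix `u` marks a union, left
with the first heading named; a prefix `x` marks a cross, wire 1 named first. -/
def ee : Tile := .wire .east .east
def en : Tile := .wire .east .north
def es : Tile := .wire .east .south
def ne : Tile := .wire .north .east
def nn : Tile := .wire .north .north
def nw : Tile := .wire .north .west
def o : Tile := .blank
def rd : Tile := .boxRead .north false
def se : Tile := .wire .south .east
def ss : Tile := .wire .south .south
def sw : Tile := .wire .south .west
def ues : Tile := .union .east .south .east
def uws : Tile := .union .west .south .west
def wn : Tile := .wire .west .north
def wr : Tile := .boxWrite .north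
def ws : Tile := .wire .west .south
def ww : Tile := .wire .west .west
def xen : Tile := .cross .east .north
def xes : Tile := .cross .east .south
def xwn : Tile := .cross .west .north
def xws : Tile := .cross .west .south

/-- Two bits are copied. -/
def idTable : List (List Tile) := [
  [ws, rd, es, o, o, o, o, rd, o, o, o, o, o, o, o, o, ws, rd, es],
    -- The first visit runs straight west along this row, as wire 1 of its crosses; this opens the
    -- wires of the boxes above for the return, which enters and leaves by the next row.
    [xws, xwn, xws, ww, ww, ww, ww, ww, ww, ww, ww, ww, ww, ww, ww, ww, xws, xwn, xws, ww, ww, ww,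
    ww, ww, ww, ww, ww, ww, ww, ww, ww, ww],
    [xes, en, ss, o, ne, ee, ee, ee, ee, ee, ee, ee, ee, ee, ee, ee, xes, en, ss, o, ne, ee, ee, ee,
    ee, ee, ee, ee, ee, ee, ee, ee],
  -- A bit read as 0 makes the signal set the box below, a bit read as 1 bypasses it, so that this
  -- box holds the complement. The same construction at the bottom of the window complements once
  -- more.
  [se, wr, ues, es, nn, o, o, o, o, o, o, o, o, o, o, o, se, wr, ues, es, nn],
  [ws, rd, es, ss, nn, o, o, o, o, o, o, o, o, o, o, o, ws, rd, es, ss, nn],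
  [ss, nn, ss, ss, nn, o, o, o, o, o, o, o, o, o, o, o, ss, nn, ss, ss, nn],
  [ss, nn, ss, ss, nn, o, o, o, o, o, o, o, o, o, o, o, ss, nn, ss, ss, nn],
  [ss, nn, ss, ss, nn, o, o, o, o, o, o, o, o, o, o, o, ss, nn, ss, ss, nn],
  [ss, nn, ss, ss, nn, o, o, o, o, o, o, o, o, o, o, o, ss, nn, ss, ss, nn],
  [ss, nn, ss, ss, nn, o, o, o, o, o, o, o, o, o, o, o, ss, nn, ss, ss, nn],
  [ss, nn, ss, ss, nn, o, o, o, o, o, o, o, o, o, o, o, ss, nn, ss, ss, nn],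
  [ss, nn, ss, ss, nn, o, o, o, o, o, o, o, o, o, o, o, ss, nn, ss, ss, nn],
  [ss, nn, ss, ss, nn, o, o, o, o, o, o, o, o, o, o, o, ss, nn, ss, ss, nn],
  [ss, nn, ss, ss, nn, o, o, o, o, o, o, o, o, o, o, o, ss, nn, ss, ss, nn],
  [ss, nn, ss, ss, nn, o, o, o, o, o, o, o, o, o, o, o, ss, nn, ss, ss, nn],
  [ss, nn, ss, ss, nn, o, o, o, o, o, o, o, o, o, o, o, ss, nn, ss, ss, nn],
  [ss, nn, ss, ss, nn, o, o, o, o, o, o, o, o, o, o, o, ss, nn, ss, ss, nn],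
  [ss, nn, ss, ss, nn, o, o, o, o, o, o, o, o, o, o, o, ss, nn, ss, ss, nn],
  [ss, nn, ss, ss, nn, o, o, o, o, o, o, o, o, o, o, o, ss, nn, ss, ss, nn],
  [ss, nn, ss, ss, nn, o, o, o, o, o, o, o, o, o, o, o, ss, nn, ss, ss, nn],
  [ss, nn, ss, ss, nn, o, o, o, o, o, o, o, o, o, o, o, ss, nn, ss, ss, nn],
  [ss, wn, xws, sw, nn, o, o, o, o, o, o, o, o, o, o, o, ss, wn, xws, sw, nn],
  [ss, o, ss, o, nn, o, o, o, o, o, o, o, o, o, o, o, ss, o, ss, o, nn],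
  [se, wr, ues, ee, en, o, o, o, o, o, o, o, o, o, o, o, se, wr, ues, ee, en, o, o, wr]]

/-- The left bit is copied, and added modulo 2 to the right bit. -/
def addRightTable : List (List Tile) := [
  [ws, rd, es, o, o, o, o, rd, o, o, o, o, o, o, o, o, ws, rd, es],
    [xws, xwn, xws, ww, ww, ww, ww, ww, ww, ww, ww, ww, ww, ww, ww, ww, xws, xwn, xws, ww, ww, ww,
    ww, ww, ww, ww, ww, ww, ww, ww, ww, ww],
    [xes, en, se, ee, ee, ee, ee, ee, es, ne, ee, ee, ee, ee, ee, ee, xes, en, ss, ne, ee, ee, ee,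
    ee, ee, ee, ee, ee, ee, ee, ee, ee],
  [se, wr, ee, ee, wr, ee, ee, wr, ues, en, o, o, o, o, o, o, se, es, ss, nn],
  [ws, rd, es, ws, rd, es, ws, rd, es, ws, ww, ww, ww, ww, ww, ww, ww, sw, ss, nn],
  [ss, nn, ss, ss, nn, ss, ss, nn, ss, se, wr, ee, ee, ee, ee, ee, wr, ee, ues, xen, es],
  [ss, nn, ss, ss, nn, ss, ss, nn, ss, ws, rd, es, o, o, o, ws, rd, es, o, nn, ss],
  [ss, nn, ss, ss, nn, ss, ss, wn, xws, xws, xwn, xws, ww, ww, ww, xws, xwn, xws, ww, xwn, sw],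
  [ss, nn, ss, ss, nn, ss, ss, o, se, xes, en, se, ee, ee, es, ss, nn, ss, o, nn],
  [ss, nn, ss, ss, nn, ss, se, ee, ee, ues, wr, ee, ee, wr, ues, xes, xen, xes, ee, xen, es],
  [ss, nn, ss, ss, nn, ss, o, o, o, ws, rd, es, ws, rd, es, ss, nn, ss, o, nn, ss],
  [ss, nn, ss, ss, wn, xws, ww, ww, ww, xws, xwn, xws, xws, xwn, xws, xws, xwn, xws, ww, xwn, sw],
  [ss, nn, ss, ss, o, se, ee, ee, ee, xes, en, ss, ss, nn, ss, ss, nn, ss, o, nn],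
  [ss, nn, ss, se, ee, ee, ee, ee, ee, ues, wr, ues, xes, xen, xes, xes, xen, xes, ee, xen, es],
  [ss, nn, ss, o, o, o, o, o, o, ws, rd, es, ss, nn, ss, ss, nn, ss, o, nn, ss],
  [ss, nn, ss, o, o, o, o, o, o, ss, nn, ss, ss, wn, xws, xws, xwn, xws, ww, xwn, sw],
  [ss, nn, ss, o, o, o, o, o, o, ss, nn, ss, ss, o, se, xes, en, ss, o, nn],
  [ss, nn, ss, o, o, o, o, o, o, ss, nn, ss, se, ee, ee, ues, wr, ues, ee, xen, es],
  [ss, nn, ss, o, o, o, o, o, o, ss, nn, ss, o, o, o, ws, rd, es, o, nn, ss],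
  [ss, nn, ss, o, o, o, o, o, o, ss, nn, ss, o, o, o, ss, nn, ss, o, nn, ss],
  [ss, nn, ss, o, o, o, o, o, o, ss, nn, ss, o, o, o, ss, nn, ss, o, nn, ss],
  [ss, wn, xws, ww, ww, ww, ww, ww, ww, xws, xwn, xws, ww, ww, ww, xws, xwn, xws, ww, xwn, sw],
  [ss, o, ss, ne, ee, ee, ee, ee, ee, xes, en, se, ee, ee, ee, xes, en, se, es, nn],
  [se, wr, ues, en, o, o, o, o, o, se, ee, ee, ee, ee, ee, ues, ee, wr, ues, en, o, o, o, wr]]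

/-- The right bit is copied, and added modulo 2 to the left bit. -/
def addLeftTable : List (List Tile) := [
  [ws, rd, es, o, o, o, o, rd, o, o, o, o, o, o, o, o, ws, rd, es],
    [xws, xwn, xws, ww, ww, ww, ww, ww, ww, ww, ww, ww, ww, ww, ww, ww, xws, xwn, xws, ww, ww, ww,
    ww, ww, ww, ww, ww, ww, ww, ww, ww, ww],
    [xes, en, se, ee, ee, es, ne, ee, ee, ee, ee, ee, ee, ee, ee, ee, xes, en, ss, ne, ee, ee, ee,
    ee, ee, ee, ee, ee, ee, ee, ee, ee],
  [se, wr, ee, ee, wr, ues, en, o, o, o, o, o, o, o, o, o, se, es, ss, nn],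
  [ws, rd, es, ws, rd, es, ws, ww, ww, ww, ww, ww, ww, ww, ww, ww, ww, sw, ss, nn],
  [ss, nn, ss, ss, nn, ss, se, wr, ee, ee, ee, ee, ee, wr, ee, ee, ee, wr, ues, xen, es],
  [ss, nn, ss, ss, nn, ss, ws, rd, es, o, o, o, ws, rd, es, o, ws, rd, es, nn, ss],
  [ss, nn, ss, ss, wn, xws, xws, xwn, xws, ww, ww, ww, xws, xwn, xws, ww, xws, xwn, xws, xwn, sw],
  [ss, nn, ss, ss, o, se, xes, en, se, ee, ee, es, ss, nn, ss, o, ss, nn, ss, nn],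
  [ss, nn, ss, se, ee, ee, ues, wr, ee, ee, wr, ues, xes, xen, xes, ee, xes, xen, xes, xen, es],
  [ss, nn, ss, o, o, o, ws, rd, es, ws, rd, es, ss, nn, ss, o, ss, nn, ss, nn, ss],
    [ss, wn, xws, ww, ww, ww, xws, xwn, xws, xws, xwn, xws, xws, xwn, xws, ww, xws, xwn, xws, xwn,
    sw],
  [ss, o, se, ee, ee, ee, xes, en, ss, ss, nn, ss, ss, nn, ss, o, ss, nn, ss, nn],
  [se, ee, ee, ee, ee, ee, ues, wr, ues, xes, xen, xes, xes, xen, xes, ee, xes, xen, xes, xen, es],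
  [o, o, o, o, o, o, ws, rd, es, ss, nn, ss, ss, nn, ss, o, ss, nn, ss, nn, ss],
  [o, o, o, o, o, o, ss, nn, ss, ss, wn, xws, xws, xwn, xws, ww, xws, xwn, xws, xwn, sw],
  [o, o, o, o, o, o, ss, nn, ss, ss, o, se, xes, en, ss, o, ss, nn, ss, nn],
  [o, o, o, o, o, o, ss, nn, ss, se, ee, ee, ues, wr, ues, ee, xes, xen, xes, xen, es],
  [o, o, o, o, o, o, ss, nn, ss, o, o, o, ws, rd, es, o, ss, nn, ss, nn, ss],
  [o, o, o, o, o, o, ss, wn, xws, ww, ww, ww, xws, xwn, xws, ww, xws, xwn, xws, xwn, sw],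
  [o, o, o, o, o, o, ss, o, se, ee, ee, ee, xes, en, ss, o, ss, nn, ss, nn],
  [o, o, o, o, o, o, se, ee, ee, ee, ee, ee, ues, es, ss, o, ss, nn, ss, nn],
  [ws, ww, ww, ww, ww, ww, ww, ww, ww, ww, ww, ww, ww, sw, ss, ne, xes, en, ss, nn],
  [se, wr, ee, ee, ee, ee, ee, ee, ee, ee, ee, ee, ee, ee, ues, en, se, wr, ues, en, o, o, o, wr]]

/-- The left bit is copied, the right bit is replaced by the conjunction. -/
def andTable : List (List Tile) := [
  [ws, rd, es, o, o, o, o, rd, o, o, o, o, o, o, o, o, ws, rd, es],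
    [xws, xwn, xws, ww, ww, ww, ww, ww, ww, ww, ww, ww, ww, ww, ww, ww, xws, xwn, xws, ww, ww, ww,
    ww, ww, ww, ww, ww, ww, ww, ww, ww, ww],
    [xes, en, se, ee, ee, es, ne, ee, ee, ee, ee, ee, ee, ee, ee, ee, xes, en, ss, ne, ee, ee, ee,
    ee, ee, ee, ee, ee, ee, ee, ee, ee],
  [se, wr, ee, ee, wr, ues, en, o, o, o, o, o, o, o, o, o, se, wr, ues, xen, es],
  [ws, rd, es, ws, rd, es, o, o, o, o, o, o, o, o, o, o, ws, rd, es, nn, ss],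
  [ss, nn, ss, ss, wn, xws, ww, ww, ww, ww, ww, ww, ww, ww, ww, ww, xws, xwn, xws, xwn, sw],
  [ss, nn, ss, ss, o, ss, o, o, ne, ee, ee, ee, ee, ee, ee, ee, xes, en, ss, nn],
  [ss, nn, ss, se, wr, ues, ee, ee, en, o, o, o, o, o, o, o, se, wr, ues, xen, es],
  [ss, nn, ss, ws, rd, es, o, o, o, o, o, o, o, o, o, o, ws, rd, es, nn, ss],
  [ss, nn, ss, ss, wn, xws, ww, ww, ww, ww, ww, ww, ww, ww, ww, ww, xws, xwn, xws, xwn, sw],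
  [ss, nn, ss, ss, o, se, ee, ee, ee, ee, ee, ee, ee, ee, ee, ee, xes, en, ss, nn],
  [ss, nn, ss, se, ee, ee, ee, ee, ee, ee, ee, ee, ee, ee, ee, ee, ues, wr, ues, xen, es],
  [ss, nn, ss, o, o, o, o, o, o, o, o, o, o, o, o, o, ws, rd, es, nn, ss],
  [ss, nn, ss, o, o, o, o, o, o, o, o, o, o, o, o, o, ss, nn, ss, nn, ss],
  [ss, nn, ss, o, o, o, o, o, o, o, o, o, o, o, o, o, ss, nn, ss, nn, ss],
  [ss, nn, ss, o, o, o, o, o, o, o, o, o, o, o, o, o, ss, nn, ss, nn, ss],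
  [ss, nn, ss, o, o, o, o, o, o, o, o, o, o, o, o, o, ss, nn, ss, nn, ss],
  [ss, nn, ss, o, o, o, o, o, o, o, o, o, o, o, o, o, ss, nn, ss, nn, ss],
  [ss, nn, ss, o, o, o, o, o, o, o, o, o, o, o, o, o, ss, nn, ss, nn, ss],
  [ss, nn, ss, o, o, o, o, o, o, o, o, o, o, o, o, o, ss, nn, ss, nn, ss],
  [ss, nn, ss, o, o, o, o, o, o, o, o, o, o, o, o, o, ss, nn, ss, nn, ss],
  [ss, wn, xws, ww, ww, ww, ww, ww, ww, ww, ww, ww, ww, ww, ww, ww, xws, xwn, xws, xwn, sw],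
  [ss, o, ss, ne, ee, ee, ee, ee, ee, ee, ee, ee, ee, ee, ee, ee, xes, en, ss, nn],
  [se, wr, ues, en, o, o, o, o, o, o, o, o, o, o, o, o, se, wr, ues, en, o, o, o, wr]]

/-- Two bits are copied; the signal turns here at the two ends of a sweep. -/
def turnTable : List (List Tile) := [
    [ws, rd, es, o, o, o, ws, rd, es, o, ss, ws, ww, ww, nw, o, ws, rd, es, o, o, o, o, o, o, ws,
    ww, ww, nw],
    [xws, xwn, xws, ww, ww, nw, ss, wn, xws, ww, uws, sw, ws, ww, xwn, ww, xws, xwn, xws, ww, ww,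
    ww, ww, ww, ww, sw, ws, ww, xwn, ww, ww, ww],
    -- The box under column 8 is set if the flag is 0, and then sends the signal back before it
    -- reaches the left bit. Those under columns 14 and 28 are set only if the signal arrives from
    -- the east; on the return, the former decides whether the right bit is read and the latter
    -- whether the exit is east or south.
    [xes, en, ss, o, o, nn, se, wr, ues, es, o, o, se, wr, en, o, ss, nn, ss, o, o, o, o, o, o, o,
    se, wr, en, ne, ee, ee],
    [se, wr, ues, es, o, wn, ww, rd, es, ss, o, o, ws, rd, es, o, ss, nn, ss, o, o, o, o, o, o, o,
    ws, rd, ee, en],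
    [ws, rd, es, ss, o, o, o, wn, xws, sw, o, o, ss, nn, ss, o, ss, nn, ss, o, o, o, o, o, o, o, ss,
    nn],
    [ss, nn, ss, ss, o, o, o, o, ss, o, o, o, ss, nn, ss, o, ss, nn, ss, o, o, o, o, o, ne, ee, xes,
    en],
  [ss, nn, ss, ss, o, o, o, o, ss, o, o, o, ss, nn, ss, o, ss, nn, ss, o, o, o, o, o, nn, o, ss],
  [ss, nn, ss, ss, o, o, o, o, ss, o, o, o, ss, nn, ss, o, ss, nn, ss, o, o, o, o, o, nn, o, ss],
    [ss, nn, ss, ss, ne, ee, ee, ee, ues, ee, ee, ee, xes, en, se, ee, xes, en, ss, o, o, o, o, o,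
    nn, o, ss],
    [ss, nn, ss, ss, nn, o, o, o, o, o, o, o, se, ee, ee, ee, ues, wr, ues, es, o, o, o, o, nn, o,
    ss],
  [ss, nn, ss, ss, nn, o, o, o, o, o, o, o, o, o, o, o, ws, rd, es, ss, o, o, o, o, nn, o, ss],
  [ss, nn, ss, ss, nn, o, o, o, o, o, o, o, o, o, o, o, ss, nn, ss, ss, o, o, o, o, nn, o, ss],
  [ss, nn, ss, ss, nn, o, o, o, o, o, o, o, o, o, o, o, ss, nn, ss, ss, o, o, o, o, nn, o, ss],
  [ss, nn, ss, ss, nn, o, o, o, o, o, o, o, o, o, o, o, ss, nn, ss, ss, o, o, o, o, nn, o, ss],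
  [ss, nn, ss, ss, nn, o, o, o, o, o, o, o, o, o, o, o, ss, nn, ss, ss, o, o, o, o, nn, o, ss],
  [ss, nn, ss, ss, nn, o, o, o, o, o, o, o, o, o, o, o, ss, nn, ss, ss, o, o, o, o, nn, o, ss],
  [ss, nn, ss, ss, nn, o, o, o, o, o, o, o, o, o, o, o, ss, nn, ss, ss, o, o, o, o, nn, o, ss],
  [ss, nn, ss, ss, nn, o, o, o, o, o, o, o, o, o, o, o, ss, nn, ss, ss, o, o, o, o, nn, o, ss],
  [ss, nn, ss, ss, nn, o, o, o, o, o, o, o, o, o, o, o, ss, nn, ss, ss, o, o, o, o, nn, o, ss],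
  [ss, nn, ss, ss, nn, o, o, o, o, o, o, o, o, o, o, o, ss, nn, ss, ss, o, o, o, o, nn, o, ss],
  [ss, nn, ss, ss, nn, o, o, o, o, o, o, o, o, o, o, o, ss, nn, ss, ss, o, o, o, o, nn, o, ss],
  [ss, wn, xws, sw, nn, o, o, o, o, o, o, o, o, o, o, o, ss, wn, xws, sw, o, o, o, o, nn, o, ss],
  [ss, o, ss, o, nn, o, o, o, o, o, o, o, o, o, o, o, ss, o, ss, o, o, o, o, o, nn, o, ss],
    [se, wr, ues, ee, en, o, o, o, o, o, o, o, o, o, o, o, se, wr, ues, ee, ee, ee, ee, wr, en, o,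
    ss]]

end Glyph

/-- Entry in row `y` and column `x` of a table, both counted from 1. -/
def entry (T : List (List Tile)) (x y : ℕ) : Tile :=
  (T.getD (y - 1) []).getD (x - 1) .blank

/-- The same tile with another initial state of the box. -/
def Tile.withState (b : Bool) : Tile → Tile
  | .boxRead u _ => .boxRead u b
  | t => t

/-- Number of a cell of a window. -/
def cellIndex (x y : ℕ) : ℕ := y * 64 + x

/-- Number of a heading. -/
def Dir.index : Dir → ℕ
  | .north => 0
  | .east => 1
  | .south => 2
  | .west => 3

/-- Number of a port of a window. -/
def portIndex (x y : ℕ) (d : Dir) : ℕ := cellIndex x y * 4 + d.index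

/-- The set of numbers `m` with the element `i` added; sets are given by their binary digits. -/
def addBit (m i : ℕ) : ℕ := m ||| 2 ^ i

/-- A signal inside a window, or at a port through which it has just left the window.  Columns
are counted from 1 to 32 and rows from 1 to 24; row 25 belongs to the windows below. -/
structure Local where
  x : ℕ
  y : ℕ
  dir : Dir
  /-- the boxes in state 1 -/
  on : ℕ
  /-- the ports that have been used -/
  used : ℕ

/-- The signal is inside the window. -/
def Local.inside (l : Local) : Bool :=
  Nat.ble 1 l.x && Nat.ble l.x 32 && Nat.ble 1 l.y && Nat.ble l.y 24

def Dir.beq (a b : Dir) : Bool := Nat.beq a.index b.index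

/-- Heading after passing a device, and whether a box is set. -/
def passage (t : Tile) (d : Dir) (here below : Bool) (usedHere : Dir → Bool) :
    Option (Dir × Bool) :=
  match t with
  | .blank => none
  | .wire i o => if d.beq i then some (o, false) else none
  | .union i j o => if d.beq i || d.beq j then some (o, false) else none
  | .cross i j =>
      if d.beq i then some (i, false)
      else if d.beq j && usedHere i then some (j, false) else none
  | .boxRead u _ =>
      if u.beq .north && d.beq .north then some (bif here then .east else .west, false) else none
  | .boxWrite u =>
      if u.beq .north && d.beq .east && !below then some (.east, true) else none

def moveX (x : ℕ) : Dir → ℕ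
  | .east => x + 1
  | .west => x - 1
  | _ => x

def moveY (y : ℕ) : Dir → ℕ
  | .south => y + 1
  | .north => y - 1
  | _ => y

/-- One step of a signal inside a window. -/
def Local.step (T : List (List Tile)) (l : Local) : Option Local :=
  match passage (entry T l.x l.y) l.dir (l.on.testBit (cellIndex l.x l.y))
      (l.on.testBit (cellIndex l.x (l.y + 1))) (fun d => l.used.testBit (portIndex l.x l.y d)) with
  | none => none
  | some (o, w) =>
      let x := moveX l.x o
      let y := moveY l.y o
      if l.used.testBit (portIndex x y o) then none
      else some ⟨x, y, o, bif w then addBit l.on (cellIndex l.x (l.y + 1)) else l.on,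
        addBit l.used (portIndex x y o)⟩

/-- Run inside a window, until the signal leaves it. -/
def Local.run (T : List (List Tile)) : ℕ → Local → Option Local
  | 0, _ => none
  | n + 1, l =>
      match l.step T with
      | none => none
      | some l' => bif l'.inside then Local.run T n l' else some l'

/-- The port of the plane corresponding to a place in the window with the given corner. -/
def place (b : Cell) (x y : ℕ) : Cell := (b.1 + x, b.2 - y)

/-! ### Soundness of computed runs inside a window -/

theorem Dir.beq_iff {a b : Dir} : a.beq b = true ↔ a = b := by
  cases a <;> cases b <;> decide

theorem testBit_addBit (m i j : ℕ) : (addBit m i).testBit j = (m.testBit j || decide (i = j)) := by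
  simp [addBit, Nat.testBit_or, Nat.testBit_two_pow]

/-- The window with corner `b` of the diagram has the content `T`, up to initial states. -/
def Shows (E : Diagram) (b : Cell) (T : List (List Tile)) : Prop :=
  ∀ x y : ℕ, 1 ≤ x → x ≤ 32 → 1 ≤ y → y ≤ 24 →
    ∃ i, E.tile (place b x y) = (entry T x y).withState i

/-- The states of the boxes in the window, including the row below, are those given by `on`. -/
def StateIs (c : Config) (b : Cell) (h : ℕ) (on : ℕ) : Prop :=
  ∀ x y : ℕ, 1 ≤ x → x ≤ 32 → 1 ≤ y → y ≤ h → c.state (place b x y) = on.testBit (cellIndex x y)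

/-- The used ports in the window are those given by `used`. -/
def UsedIs (c : Config) (b : Cell) (used : ℕ) : Prop :=
  ∀ (x y : ℕ) (d : Dir), 1 ≤ x → x ≤ 32 → 1 ≤ y → y ≤ 24 →
    ((place b x y, d) ∈ c.used ↔ used.testBit (portIndex x y d) = true)

/-- Cells of the window with corner `b`, extended to `h` rows. -/
def window (b : Cell) (h : ℕ) : Set Cell :=
  {z | b.1 + 1 ≤ z.1 ∧ z.1 ≤ b.1 + 32 ∧ b.2 - h ≤ z.2 ∧ z.2 ≤ b.2 - 1}

theorem place_mem_window {b : Cell} {h x y : ℕ} :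
    place b x y ∈ window b h ↔ 1 ≤ x ∧ x ≤ 32 ∧ 1 ≤ y ∧ y ≤ h := by
  simp only [place, window, Set.mem_ofPred_eq]; omega

theorem place_inj {b : Cell} {x y x' y' : ℕ} :
    place b x y = place b x' y' ↔ x = x' ∧ y = y' := by
  simp only [place, Prod.mk.injEq]; omega

theorem exists_place {b z : Cell} {h : ℕ} (hz : z ∈ window b h) :
    ∃ x y : ℕ, z = place b x y ∧ 1 ≤ x ∧ x ≤ 32 ∧ 1 ≤ y ∧ y ≤ h := by
  obtain ⟨z1, z2⟩ := z
  simp only [window, Set.mem_ofPred_eq] at hz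
  refine ⟨(z1 - b.1).toNat, (b.2 - z2).toNat, ?_, ?_⟩
  · simp only [place, Prod.mk.injEq]; omega
  · omega

theorem portIndex_inj {x y x' y' : ℕ} {d d' : Dir} (hx : x < 64) (hx' : x' < 64) :
    portIndex x y d = portIndex x' y' d' ↔ x = x' ∧ y = y' ∧ d = d' := by
  simp only [portIndex, cellIndex]
  cases d <;> cases d' <;> simp only [Dir.index, reduceCtorEq, and_false, and_true, iff_false] <;>
    omega

theorem cellIndex_inj {x y x' y' : ℕ} (hx : x < 64) (hx' : x' < 64) :
    cellIndex x y = cellIndex x' y' ↔ x = x' ∧ y = y' := by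
  simp only [cellIndex]; omega

/-- Only current states enter the rules, so the initial state `i` is arbitrary. Rows are counted
southwards, hence the reading half belonging to a writing half in row `y` is in row `y + 1`. -/
theorem passes_of_passage {E : Diagram} {c : Config} {b : Cell} {t : Tile} {x y : ℕ} {d o : Dir}
    {here below w : Bool} {usedHere : Dir → Bool} {i : Bool}
    (hs : c.signal = (place b x y, d)) (ht : E.tile (place b x y) = t.withState i)
    (hhere : c.state (place b x y) = here) (hbelow : c.state (place b x (y + 1)) = below)
    (hu : ∀ e, usedHere e = true → (place b x y, e) ∈ c.used)
    (hp : passage t d here below usedHere = some (o, w)) :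
    Passes E c o (bif w then Function.update c.state (place b x (y + 1)) true else c.state) := by
  have h1 : c.signal.1 = place b x y := by rw [hs]
  have h2 : c.signal.2 = d := by rw [hs]
  rw [← h1] at ht hhere
  cases t with
  | blank => simp [passage] at hp
  | wire i o' =>
    simp only [passage] at hp
    split_ifs at hp with h
    simp only [Option.some.injEq, Prod.mk.injEq] at hp
    obtain ⟨rfl, rfl⟩ := hp
    exact .wire i o' ht (h2.trans (Dir.beq_iff.1 h))
  | union i j o' =>
    simp only [passage] at hp
    split_ifs at hp with h
    simp only [Option.some.injEq, Prod.mk.injEq] at hp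
    obtain ⟨rfl, rfl⟩ := hp
    rw [Bool.or_eq_true] at h
    rcases h with h | h
    · exact .union_fst i j o' ht (h2.trans (Dir.beq_iff.1 h))
    · exact .union_snd i j o' ht (h2.trans (Dir.beq_iff.1 h))
  | cross i j =>
    simp only [passage] at hp
    split_ifs at hp with h h'
    · simp only [Option.some.injEq, Prod.mk.injEq] at hp
      obtain ⟨rfl, rfl⟩ := hp
      exact .cross_fst i j ht (h2.trans (Dir.beq_iff.1 h))
    · simp only [Option.some.injEq, Prod.mk.injEq] at hp
      obtain ⟨rfl, rfl⟩ := hp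
      rw [Bool.and_eq_true] at h'
      exact .cross_snd i j ht (h2.trans (Dir.beq_iff.1 h'.1)) (by rw [h1]; exact hu _ h'.2)
  | boxRead u s =>
    simp only [passage] at hp
    split_ifs at hp with h
    simp only [Option.some.injEq, Prod.mk.injEq] at hp
    obtain ⟨rfl, rfl⟩ := hp
    rw [Bool.and_eq_true, Dir.beq_iff, Dir.beq_iff] at h
    obtain ⟨rfl, rfl⟩ := h
    cases here
    · exact .read_zero .north i ht h2 hhere
    · exact .read_one .north i ht h2 hhere
  | boxWrite u =>
    simp only [passage] at hp
    split_ifs at hp with h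
    simp only [Option.some.injEq, Prod.mk.injEq] at hp
    obtain ⟨rfl, rfl⟩ := hp
    simp only [Bool.and_eq_true, Dir.beq_iff, Bool.not_eq_true'] at h
    obtain ⟨⟨rfl, rfl⟩, hb⟩ := h
    have h3 : c.signal.1 - Dir.north.vec = place b x (y + 1) := by
      rw [h1]; simp only [place, Dir.vec, Prod.mk_sub_mk, Prod.mk.injEq]; push_cast; omega
    have := Passes.write (D := E) (c := c) .north ht h2 (by rw [h3, hbelow, hb])
    rw [h3] at this
    exact this

theorem place_add_vec {b : Cell} {x y : ℕ} (hx : 1 ≤ x) (hy : 1 ≤ y) (o : Dir) :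
    place b x y + o.vec = place b (moveX x o) (moveY y o) := by
  cases o <;> simp only [place, Dir.vec, moveX, moveY, Prod.mk_add_mk, Prod.mk.injEq] <;> omega

/-- The situation `c` in the window with corner `b` is described by `l`. -/
structure Describes (b : Cell) (l : Local) (c : Config) : Prop where
  signal : c.signal = (place b l.x l.y, l.dir)
  state : StateIs c b 25 l.on
  used : UsedIs c b l.used

/-- What a passage through a window leaves unchanged. -/
structure SameOutside (b : Cell) (c c' : Config) : Prop where
  state : ∀ z, z ∉ window b 25 → c'.state z = c.state z
  used : ∀ p : Port, p.1 ∉ window b 24 → (p ∈ c'.used ↔ p ∈ c.used ∨ p = c'.signal)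

theorem Local.inside_iff {l : Local} :
    l.inside = true ↔ (1 ≤ l.x ∧ l.x ≤ 32) ∧ 1 ≤ l.y ∧ l.y ≤ 24 := by
  simp only [Local.inside, Bool.and_eq_true, Nat.ble_eq]; tauto

theorem Local.mem_window_iff {l : Local} {b : Cell} :
    place b l.x l.y ∈ window b 24 ↔ l.inside = true := by
  rw [place_mem_window, Local.inside_iff]; tauto

/-- The digits of `l.used` record the used ports of this window only; that a port outside is still
free has to be supplied by `hfree`. -/
theorem Local.step_sound {E : Diagram} {b : Cell} {T : List (List Tile)} (hT : Shows E b T)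
    {l l' : Local} {c : Config} (hin : l.inside = true) (h : l.step T = some l')
    (hc : Describes b l c)
    (hfree : l'.inside = false → (place b l'.x l'.y, l'.dir) ∉ c.used) :
    ∃ c', Step E c c' ∧ Describes b l' c' ∧
      (∀ z, z ∉ window b 25 → c'.state z = c.state z) ∧
      c'.used = insert c'.signal c.used := by
  obtain ⟨⟨hx1, hx2⟩, hy1, hy2⟩ := Local.inside_iff.1 hin
  unfold Local.step at h
  generalize hp : passage _ _ _ _ _ = r at h
  cases r with
  | none => simp at h
  | some ow =>
  obtain ⟨o, w⟩ := ow
  simp only at h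
  split_ifs at h with hused
  simp only [Option.some.injEq] at h
  subst h
  obtain ⟨i, hi⟩ := hT l.x l.y hx1 hx2 hy1 hy2
  have hpass := passes_of_passage hc.signal hi (hc.state _ _ hx1 hx2 hy1 (by omega))
    (hc.state _ _ hx1 hx2 (by omega) (by omega))
    (fun e he => (hc.used _ _ e hx1 hx2 hy1 hy2).2 he) hp
  have hmove : c.signal.1 + o.vec = place b (moveX l.x o) (moveY l.y o) := by
    rw [hc.signal]; exact place_add_vec hx1 hy1 o
  have hmx : moveX l.x o < 64 := by cases o <;> simp only [moveX] <;> omega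
  have hnot : (c.signal.1 + o.vec, o) ∉ c.used := by
    rw [hmove]
    by_cases hin' : place b (moveX l.x o) (moveY l.y o) ∈ window b 24
    · obtain ⟨h1, h2, h3, h4⟩ := place_mem_window.1 hin'
      rw [hc.used _ _ _ h1 h2 h3 h4]
      exact hused
    · refine hfree ?_
      rw [← Bool.not_eq_true, ← Local.mem_window_iff (b := b)]
      exact hin'
  refine ⟨_, ⟨o, _, hpass, hnot, rfl⟩, ⟨?_, ?_, ?_⟩, ?_, rfl⟩
  · simp only [hmove]
  · intro x y h1 h2 h3 h4
    have h0 := hc.state x y h1 h2 h3 h4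
    cases w
    · exact h0
    · simp only [cond_true, testBit_addBit, ← h0, Function.update_apply, place_inj,
        cellIndex_inj (show l.x < 64 by omega) (show x < 64 by omega)]
      by_cases hxy : x = l.x ∧ y = l.y + 1
      · simp [hxy]
      · rw [if_neg hxy]
        have : ¬ (l.x = x ∧ l.y + 1 = y) := by omega
        simp [this]
  · intro x y d h1 h2 h3 h4
    have h0 := hc.used x y d h1 h2 h3 h4
    simp only [hmove, Set.mem_insert_iff, Prod.mk.injEq, place_inj, h0, testBit_addBit,
      Bool.or_eq_true, decide_eq_true_eq, portIndex_inj hmx (show x < 64 by omega)]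
    constructor
    · rintro (⟨⟨rfl, rfl⟩, rfl⟩ | h)
      · exact Or.inr ⟨rfl, rfl, rfl⟩
      · exact Or.inl h
    · rintro (h | ⟨rfl, rfl, rfl⟩)
      · exact Or.inr h
      · exact Or.inl ⟨⟨rfl, rfl⟩, rfl⟩
  · intro z hz
    cases w
    · rfl
    · simp only [cond_true]
      rw [Function.update_of_ne]
      rintro rfl
      exact hz (place_mem_window.2 ⟨hx1, hx2, by omega, by omega⟩)

theorem Local.run_sound {E : Diagram} {b : Cell} {T : List (List Tile)} (hT : Shows E b T) {n : ℕ}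
    {l l' : Local} {c : Config} (hin : l.inside = true) (h : l.run T n = some l')
    (hc : Describes b l c) (hfree : (place b l'.x l'.y, l'.dir) ∉ c.used) :
    ∃ c', Relation.TransGen (Step E) c c' ∧ Describes b l' c' ∧ SameOutside b c c' := by
  induction n generalizing l c with
  | zero => simp [Local.run] at h
  | succ n ih =>
    unfold Local.run at h
    cases hs : l.step T with
    | none => simp [hs] at h
    | some l₁ =>
      simp only [hs] at h
      cases hin₁ : l₁.inside with
      | false =>
        simp only [hin₁, cond_false, Option.some.injEq] at h
        subst h
        obtain ⟨c', h1, h2, h3, h4⟩ := Local.step_sound hT hin hs hc (fun _ => hfree)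
        refine ⟨c', .single h1, h2, h3, fun p _ => ?_⟩
        rw [h4, Set.mem_insert_iff, or_comm]
      | true =>
        simp only [hin₁, cond_true] at h
        obtain ⟨c₁, h1, h2, h3, h4⟩ := Local.step_sound hT hin hs hc (by simp [hin₁])
        have hsig : c₁.signal.1 ∈ window b 24 := by
          rw [h2.signal]; exact Local.mem_window_iff.2 hin₁
        -- A run stops only outside of the window, so its last port differs from the one entered
        -- now, and remains free.
        have hout : l'.inside = false := by
          clear ih hs hc hfree h1 h2 h3 h4 hin hsig
          induction n generalizing l₁ with
          | zero => simp [Local.run] at h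
          | succ n ih =>
            unfold Local.run at h
            cases hs : l₁.step T with
            | none => simp [hs] at h
            | some l₂ =>
              simp only [hs] at h
              cases hin₂ : l₂.inside with
              | false => simp only [hin₂, cond_false, Option.some.injEq] at h; rwa [← h]
              | true => rw [hin₂] at h; exact ih l₂ hin₂ h
        have hne : ((place b l'.x l'.y, l'.dir) : Port) ≠ c₁.signal := by
          intro he
          rw [← he] at hsig
          simp [Local.mem_window_iff.1 hsig] at hout
        obtain ⟨c', k1, k2, k3⟩ := ih hin₁ h h2 (by
          rw [h4, Set.mem_insert_iff]; exact not_or.2 ⟨hne, hfree⟩)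
        refine ⟨c', .head h1 k1, k2, fun z hz => (k3.state z hz).trans (h3 z hz), fun p hp => ?_⟩
        rw [k3.used p hp, h4, Set.mem_insert_iff]
        have : p ≠ c₁.signal := fun he => hp (he ▸ hsig)
        tauto

/-! ## Runs through single windows -/

/-- The gates realised by windows. -/
inductive Gate where
  | id
  | addRight
  | addLeft
  | and

/-- The action of a gate on a left and a right bit. -/
def Gate.apply : Gate → Bool → Bool → Bool × Bool
  | .id, l, r => (l, r)
  | .addRight, l, r => (l, xor l r)
  | .addLeft, l, r => (xor l r, r)
  | .and, l, r => (l, l && r)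

/-- The window that realises a gate. -/
def Gate.table : Gate → List (List Tile)
  | .id => Glyph.idTable
  | .addRight => Glyph.addRightTable
  | .addLeft => Glyph.addLeftTable
  | .and => Glyph.andTable

/-- The number whose only binary digit is at place `i`, or 0. -/
def optBit (b : Bool) (i : ℕ) : ℕ := bif b then 2 ^ i else 0

/-- States of the boxes of a window before it is visited: a left and a right bit, and a flag. -/
def inputs (l r v : Bool) : ℕ :=
  optBit l (cellIndex 2 1) ||| optBit r (cellIndex 18 1) ||| optBit v (cellIndex 8 1)

/-- States of the boxes in the row below a window after it has been visited. -/
def outputs (l r v : Bool) : ℕ :=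
  optBit l (cellIndex 2 0) ||| optBit r (cellIndex 18 0) ||| optBit v (cellIndex 24 0)

/-- The signal enters an unused window from the east. -/
def sweepIn (on : ℕ) : Local := ⟨32, 2, .west, on, addBit 0 (portIndex 32 2 .west)⟩

/-- The signal enters an unused window from the north. -/
def startIn (on : ℕ) : Local := ⟨11, 1, .south, on, addBit 0 (portIndex 11 1 .south)⟩

/-- The signal comes back to a window from the west. -/
def backIn (a : Local) : Local := ⟨1, 3, .east, a.on, addBit a.used (portIndex 1 3 .east)⟩

/-- An upper bound for the number of steps in a window. -/
def fuel : ℕ := 500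

/-- The result of the first run through a window. -/
def swept (T : List (List Tile)) (l : Local) : Local := (l.run T fuel).getD l

/-- The signal leaves in the given way, with a property of the final situation. -/
def leavesBy (r : Option Local) (x y : ℕ) (d : Dir) (P : Local → Bool) : Bool :=
  match r with
  | none => false
  | some a => Nat.beq a.x x && Nat.beq a.y y && a.dir.beq d && P a

/-- The situation after the second visit of a window. -/
def finished (l r l' r' v' : Bool) (b : Local) : Bool :=
  (b.on.testBit (cellIndex 2 1) == l) && (b.on.testBit (cellIndex 18 1) == r) &&
    Nat.beq (b.on >>> 1600) (outputs l' r' v')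

/-- The situation after the first visit of a window. -/
def half (l r : Bool) (a : Local) : Bool :=
  (a.on.testBit (cellIndex 2 1) == l) && (a.on.testBit (cellIndex 18 1) == r) &&
    Nat.beq (a.on >>> 1600) 0 && !a.used.testBit (portIndex 1 3 .east)

/-- The window is passed first from a start to the west, and then from the west to an end. -/
def Passable (T : List (List Tile)) (start : Local) (x y : ℕ) (d : Dir) (l r l' r' v' : Bool) :
    Bool :=
  leavesBy (start.run T fuel) 0 2 .west fun a => half l r a &&
    leavesBy ((backIn a).run T fuel) x y d (finished l r l' r' v')

/-- A finite check by evaluation. Gate windows have flag boxes too, which are present only because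
all tables share the same boundary; these stay in state 0. -/
theorem passable_gate (g : Gate) (l r : Bool) :
    Passable g.table (sweepIn (inputs l r false)) 33 3 .east l r (g.apply l r).1 (g.apply l r).2
      false = true := by
  cases g <;> cases l <;> cases r <;> decide +kernel

theorem passable_turn (l r : Bool) :
    Passable Glyph.turnTable (sweepIn (inputs l r true)) 33 3 .east l r l r true = true := by
  cases l <;> cases r <;> decide +kernel

/-- The starting signal joins the westward row to the west of the right bit, whose crosses therefore
stay closed. So this bit cannot be read and is required to be 0. -/
theorem passable_start (l : Bool) :
    Passable Glyph.turnTable (startIn (inputs l false true)) 27 25 .south l false l false true =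
      true := by
  cases l <;> decide +kernel

/-- The signal turns before the crosses at the left bit, which is therefore required to be 0. The
flag goes from 0 to 1, so that the next layer extends further west. -/
theorem leavesBy_turn (r : Bool) :
    leavesBy ((sweepIn (inputs false r false)).run Glyph.turnTable fuel) 33 3 .east
      (finished false r false r true) = true := by
  cases r <;> decide +kernel

theorem testBit_optBit (b : Bool) (i j : ℕ) : (optBit b i).testBit j = (b && decide (i = j)) := by
  cases b <;> simp [optBit, Nat.testBit_two_pow]

theorem testBit_inputs (l r v : Bool) {x y : ℕ} (hx : x < 64) :
    (inputs l r v).testBit (cellIndex x y) = true ↔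
      y = 1 ∧ ((x = 2 ∧ l = true) ∨ (x = 18 ∧ r = true) ∨ (x = 8 ∧ v = true)) := by
  simp only [inputs, Nat.testBit_or, testBit_optBit, Bool.or_eq_true, Bool.and_eq_true,
    decide_eq_true_eq, cellIndex]
  constructor
  · rintro ((⟨h, _⟩ | ⟨h, _⟩) | ⟨h, _⟩) <;> refine ⟨by omega, ?_⟩
    · exact Or.inl ⟨by omega, h⟩
    · exact Or.inr (Or.inl ⟨by omega, h⟩)
    · exact Or.inr (Or.inr ⟨by omega, h⟩)
  · rintro ⟨rfl, ⟨rfl, h⟩ | ⟨rfl, h⟩ | ⟨rfl, h⟩⟩ <;> simp [h]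

theorem testBit_outputs (l r v : Bool) (x : ℕ) :
    (outputs l r v).testBit x = true ↔
      (x = 2 ∧ l = true) ∨ (x = 18 ∧ r = true) ∨ (x = 24 ∧ v = true) := by
  simp only [outputs, Nat.testBit_or, testBit_optBit, Bool.or_eq_true, Bool.and_eq_true,
    decide_eq_true_eq, cellIndex]
  constructor
  · rintro ((⟨h, h'⟩ | ⟨h, h'⟩) | ⟨h, h'⟩)
    · exact Or.inl ⟨by omega, h⟩
    · exact Or.inr (Or.inl ⟨by omega, h⟩)
    · exact Or.inr (Or.inr ⟨by omega, h⟩)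
  · rintro (⟨rfl, h⟩ | ⟨rfl, h⟩ | ⟨rfl, h⟩) <;> simp [h]

/-- Since 1600 = 25 * 64, the shift discards the digits of rows 0 to 24. -/
theorem testBit_row_below {n k : ℕ} (h : n >>> 1600 = k) (x : ℕ) :
    n.testBit (cellIndex x 25) = k.testBit x := by
  rw [← h, Nat.testBit_shiftRight]; rfl

theorem leavesBy_iff {r : Option Local} {x y : ℕ} {d : Dir} {P : Local → Bool} :
    leavesBy r x y d P = true ↔
      ∃ a, r = some a ∧ a.x = x ∧ a.y = y ∧ a.dir = d ∧ P a = true := by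
  cases r with
  | none => simp [leavesBy]
  | some a => simp [leavesBy, Dir.beq_iff, and_assoc]

theorem half_iff {l r : Bool} {a : Local} : half l r a = true ↔
    a.on.testBit (cellIndex 2 1) = l ∧ a.on.testBit (cellIndex 18 1) = r ∧ a.on >>> 1600 = 0 ∧
      a.used.testBit (portIndex 1 3 .east) = false := by
  simp only [half, Bool.and_eq_true, beq_iff_eq, Nat.beq_eq, Bool.not_eq_true', and_assoc]

theorem finished_iff {l r l' r' v' : Bool} {a : Local} : finished l r l' r' v' a = true ↔
    a.on.testBit (cellIndex 2 1) = l ∧ a.on.testBit (cellIndex 18 1) = r ∧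
      a.on >>> 1600 = outputs l' r' v' := by
  simp only [finished, Bool.and_eq_true, beq_iff_eq, Nat.beq_eq, and_assoc]

/-! ## Layers of windows -/

/-- The corner of window `m` of layer `s`; it lies outside of the window. -/
def corner (s m : ℤ) : Cell := (32 * m + 16 * s - 1, -24 * s + 1)

/-- The box that holds the bit in column `e` when layer `s` starts. -/
def dataCell (s e : ℤ) : Cell := (16 * e + 1, -24 * s)

/-- The box that holds the flag of window `m` when layer `s` starts. -/
def flagCell (s m : ℤ) : Cell := (32 * m + 16 * s + 7, -24 * s)

/-- Columns of bits are 16 cells apart, half the width of a window, and each layer is shifted by 16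
cells. Hence window `m` of layer `s` has columns `2 * m + s` and `2 * m + s + 1`. -/
theorem place_corner_eq_dataCell {s m s' e : ℤ} {x y : ℕ} (hx : 1 ≤ x ∧ x ≤ 32)
    (hy : 1 ≤ y ∧ y ≤ 24) :
    place (corner s m) x y = dataCell s' e ↔ s' = s ∧ y = 1 ∧
      ((x = 2 ∧ e = 2 * m + s) ∨ (x = 18 ∧ e = 2 * m + s + 1)) := by
  simp only [place, corner, dataCell, Prod.mk.injEq]; omega

theorem place_corner_eq_flagCell {s m s' m' : ℤ} {x y : ℕ} (hx : 1 ≤ x ∧ x ≤ 32)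
    (hy : 1 ≤ y ∧ y ≤ 24) :
    place (corner s m) x y = flagCell s' m' ↔ s' = s ∧ y = 1 ∧ x = 8 ∧ m' = m := by
  simp only [place, corner, flagCell, Prod.mk.injEq]; omega

theorem place_corner_below_eq_dataCell {s m s' e : ℤ} {x : ℕ} (hx : 1 ≤ x ∧ x ≤ 32) :
    place (corner s m) x 25 = dataCell s' e ↔ s' = s + 1 ∧
      ((x = 2 ∧ e = 2 * m + s) ∨ (x = 18 ∧ e = 2 * m + s + 1)) := by
  simp only [place, corner, dataCell, Prod.mk.injEq]; omega

theorem place_corner_below_eq_flagCell {s m s' m' : ℤ} {x : ℕ} (hx : 1 ≤ x ∧ x ≤ 32) :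
    place (corner s m) x 25 = flagCell s' m' ↔ s' = s + 1 ∧ x = 24 ∧ m' = m := by
  simp only [place, corner, flagCell, Prod.mk.injEq]; omega

theorem dataCell_ne_flagCell (s e s' m : ℤ) : dataCell s e ≠ flagCell s' m := by
  simp only [ne_eq, dataCell, flagCell, Prod.mk.injEq]; omega

/-- The cells of the windows of layer `s` lie above this line. -/
def floor (s : ℤ) : ℤ := -24 * (s + 1)

/-- While the signal travels in layer `s`, the windows `a, ..., b` are in the situations given by
`f` (boxes in state 1 and used ports), the layers below are unused, and their boxes in state 1 are
given by `β`. -/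
structure InLayer (s a b : ℤ) (f : ℤ → ℕ × ℕ) (β : Cell → Prop) (c : Config) : Prop where
  state : ∀ m, a ≤ m → m ≤ b → StateIs c (corner s m) 24 (f m).1
  used : ∀ m, a ≤ m → m ≤ b → UsedIs c (corner s m) (f m).2
  below : ∀ z : Cell, z.2 ≤ floor s → (c.state z = true ↔ β z)
  fresh : ∀ p : Port, p.1.2 ≤ floor s → p ∈ c.used → p = c.signal

theorem not_mem_window_of_ne {s m m' : ℤ} (h : m' ≠ m) {x y : ℕ} (hx : 1 ≤ x ∧ x ≤ 32)
    (_hy : 1 ≤ y ∧ y ≤ 24) : place (corner s m') x y ∉ window (corner s m) 25 := by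
  simp only [place, corner, window, Set.mem_ofPred_eq]; omega

theorem not_mem_window_of_ne' {s m m' : ℤ} (h : m' ≠ m) {x y : ℕ} (hx : 1 ≤ x ∧ x ≤ 32)
    (_hy : 1 ≤ y ∧ y ≤ 24) : place (corner s m') x y ∉ window (corner s m) 24 := by
  simp only [place, corner, window, Set.mem_ofPred_eq]; omega

/-- A visit of window `m` of layer `s`. -/
theorem InLayer.visit {E : Diagram} {T : List (List Tile)} {s a b m : ℤ} {f : ℤ → ℕ × ℕ}
    {β : Cell → Prop} {c : Config} (h : InLayer s a b f β c) (ha : a ≤ m) (hb : m ≤ b)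
    (hT : Shows E (corner s m) T) {l l' : Local} {n : ℕ} (hin : l.inside = true)
    (hsig : c.signal = (place (corner s m) l.x l.y, l.dir)) (hf : f m = (l.on, l.used))
    (hlow : l.on >>> 1600 = 0) (hβ : ∀ x : ℕ, 1 ≤ x → x ≤ 32 → ¬ β (place (corner s m) x 25))
    (hrun : l.run T n = some l')
    (hfree : (place (corner s m) l'.x l'.y, l'.dir) ∉ c.used)
    (h2 : l'.on.testBit (cellIndex 2 1) = l.on.testBit (cellIndex 2 1))
    (h18 : l'.on.testBit (cellIndex 18 1) = l.on.testBit (cellIndex 18 1)) :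
    ∃ c', Relation.TransGen (Step E) c c' ∧
      c'.signal = (place (corner s m) l'.x l'.y, l'.dir) ∧
      InLayer s m m (fun _ => (l'.on, l'.used))
        (fun z => β z ∨ ∃ x : ℕ, 1 ≤ x ∧ x ≤ 32 ∧ z = place (corner s m) x 25 ∧
          l'.on.testBit (cellIndex x 25) = true) c' ∧
      (∀ m', a ≤ m' → m' ≤ b → m' ≠ m → StateIs c' (corner s m') 24 (f m').1) ∧
      (∀ m', a ≤ m' → m' ≤ b → m' ≠ m → ∀ (x y : ℕ) (d : Dir), 1 ≤ x → x ≤ 32 → 1 ≤ y → y ≤ 24 →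
        ((place (corner s m') x y, d) ∈ c'.used ↔
          (f m').2.testBit (portIndex x y d) = true ∨
            (place (corner s m') x y, d) = c'.signal)) ∧
      ∀ s' e, s' ≤ s → c'.state (dataCell s' e) = c.state (dataCell s' e) := by
  -- Row 25 belongs to the next layer, where the boxes below this window have not been set yet.
  have hst : StateIs c (corner s m) 25 l.on := by
    intro x y h1 h2 h3 h4
    rcases Nat.lt_or_ge y 25 with h5 | h5
    · have := h.state m ha hb x y h1 h2 h3 (by omega)
      rwa [hf] at this
    · obtain rfl : y = 25 := by omega
      rw [testBit_row_below hlow, Nat.zero_testBit]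
      rw [← Bool.not_eq_true, h.below _ (by simp only [place, corner, floor]; omega)]
      exact hβ x h1 h2
  obtain ⟨c', h3, h4, h5⟩ := Local.run_sound hT hin hrun
    ⟨hsig, hst, by have := h.used m ha hb; rwa [hf] at this⟩ hfree
  refine ⟨c', h3, h4.signal, ⟨?_, ?_, ?_, ?_⟩, ?_, ?_, ?_⟩
  · intro m' h6 h7 x y k1 k2 k3 k4
    obtain rfl : m' = m := by omega
    exact h4.state x y k1 k2 k3 (by omega)
  · intro m' h6 h7
    obtain rfl : m' = m := by omega
    exact h4.used
  · intro z hz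
    by_cases hw : z ∈ window (corner s m) 25
    · obtain ⟨x, y, rfl, k1, k2, k3, k4⟩ := exists_place hw
      obtain rfl : y = 25 := by
        simp only [place, corner, floor] at hz; omega
      rw [h4.state x 25 k1 k2 (by omega) le_rfl]
      constructor
      · exact fun k => Or.inr ⟨x, k1, k2, rfl, k⟩
      · rintro (k | ⟨x', _, _, k5, k6⟩)
        · exact absurd k (hβ x k1 k2)
        · rw [(place_inj.1 k5).1]; exact k6
    · rw [h5.state z hw, h.below z hz]
      constructor
      · exact Or.inl
      · rintro (k | ⟨x, k1, k2, rfl, _⟩)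
        · exact k
        · exact absurd (place_mem_window.2 ⟨k1, k2, by omega, le_rfl⟩) hw
  · intro p hp hu
    rw [h5.used p (by simp only [window, corner, floor, Set.mem_ofPred_eq] at hp ⊢; omega)] at hu
    rcases hu with hu | hu
    · have := h.fresh p hp hu
      have hmem : place (corner s m) l.x l.y ∈ window (corner s m) 24 :=
        Local.mem_window_iff.2 hin
      rw [this, hsig] at hp
      simp only [window, Set.mem_ofPred_eq, corner, floor] at hmem hp
      omega
    · exact hu
  · intro m' h6 h7 hne x y k1 k2 k3 k4
    rw [h5.state _ (not_mem_window_of_ne hne ⟨k1, k2⟩ ⟨k3, k4⟩)]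
    exact h.state m' h6 h7 x y k1 k2 k3 k4
  · intro m' h6 h7 hne x y d k1 k2 k3 k4
    rw [h5.used _ (not_mem_window_of_ne' hne ⟨k1, k2⟩ ⟨k3, k4⟩),
      h.used m' h6 h7 x y d k1 k2 k3 k4]
  · intro s' e hs
    by_cases hw : dataCell s' e ∈ window (corner s m) 25
    · obtain ⟨x, y, he, k1, k2, k3, k4⟩ := exists_place hw
      have hy : y ≤ 24 := by
        simp only [place, corner, dataCell, Prod.mk.injEq] at he; omega
      obtain ⟨-, rfl, k5⟩ := (place_corner_eq_dataCell ⟨k1, k2⟩ ⟨k3, hy⟩).1 he.symm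
      rw [he, h4.state x 1 k1 k2 k3 k4, hst x 1 k1 k2 k3 k4]
      rcases k5 with ⟨rfl, _⟩ | ⟨rfl, _⟩
      · exact h2
      · exact h18
    · exact h5.state _ hw

/-- The situation in the neighbouring window when the signal enters it. -/
theorem usedIs_addBit {c : Config} {b : Cell} {u x₀ y₀ : ℕ} {d₀ : Dir} (hx₀ : x₀ < 64)
    (hsig : c.signal = (place b x₀ y₀, d₀))
    (h : ∀ (x y : ℕ) (d : Dir), 1 ≤ x → x ≤ 32 → 1 ≤ y → y ≤ 24 →
      ((place b x y, d) ∈ c.used ↔ u.testBit (portIndex x y d) = true ∨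
        (place b x y, d) = c.signal)) :
    UsedIs c b (addBit u (portIndex x₀ y₀ d₀)) := by
  intro x y d h1 h2 h3 h4
  rw [h x y d h1 h2 h3 h4, hsig, testBit_addBit, Bool.or_eq_true, decide_eq_true_eq,
    portIndex_inj hx₀ (by omega), Prod.mk.injEq, place_inj]
  tauto

theorem usedIs_of_signal_outside {c : Config} {b : Cell} {u : ℕ}
    (hsig : c.signal.1 ∉ window b 24)
    (h : ∀ (x y : ℕ) (d : Dir), 1 ≤ x → x ≤ 32 → 1 ≤ y → y ≤ 24 →
      ((place b x y, d) ∈ c.used ↔ u.testBit (portIndex x y d) = true ∨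
        (place b x y, d) = c.signal)) :
    UsedIs c b u := by
  intro x y d h1 h2 h3 h4
  rw [h x y d h1 h2 h3 h4]
  refine ⟨?_, Or.inl⟩
  rintro (k | k)
  · exact k
  · exact absurd (place_mem_window.2 ⟨h1, h2, h3, h4⟩) (by rw [← k] at hsig; exact hsig)

theorem InLayer.mono {s a b a' b' : ℤ} {f f' : ℤ → ℕ × ℕ} {β β' : Cell → Prop} {c : Config}
    (h : InLayer s a b f β c) (ha : a ≤ a') (hb : b' ≤ b)
    (hf : ∀ m, a' ≤ m → m ≤ b' → f m = f' m)
    (hβ : ∀ z : Cell, z.2 ≤ floor s → (β z ↔ β' z)) : InLayer s a' b' f' β' c where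
  state m h1 h2 := by rw [← hf m h1 h2]; exact h.state m (ha.trans h1) (h2.trans hb)
  used m h1 h2 := by rw [← hf m h1 h2]; exact h.used m (ha.trans h1) (h2.trans hb)
  below z hz := (h.below z hz).trans (hβ z hz)
  fresh := h.fresh

/-- States of boxes after window `m` of layer `s` has been visited. -/
def afterVisit (s m : ℤ) (on : ℕ) (β : Cell → Prop) (z : Cell) : Prop :=
  β z ∨ ∃ x : ℕ, 1 ≤ x ∧ x ≤ 32 ∧ z = place (corner s m) x 25 ∧
    on.testBit (cellIndex x 25) = true

/-- A visit of window `m` of layer `s`, from which the signal goes to the window `m₂`. -/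
theorem InLayer.visit_move {E : Diagram} {T : List (List Tile)} {s a b m m₂ : ℤ} {f : ℤ → ℕ × ℕ}
    {β : Cell → Prop} {c : Config} (h : InLayer s a b f β c) (ha : a ≤ m) (hb : m ≤ b)
    (ha₂ : a ≤ m₂) (hb₂ : m₂ ≤ b) (hne : m₂ ≠ m)
    (hT : Shows E (corner s m) T) {l l' : Local} {n : ℕ} (hin : l.inside = true)
    (hsig : c.signal = (place (corner s m) l.x l.y, l.dir)) (hf : f m = (l.on, l.used))
    (hlow : l.on >>> 1600 = 0) (hβ : ∀ x : ℕ, 1 ≤ x → x ≤ 32 → ¬ β (place (corner s m) x 25))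
    (hrun : l.run T n = some l') {x₂ y₂ : ℕ} (hx₂ : 1 ≤ x₂ ∧ x₂ ≤ 32) (hy₂ : 1 ≤ y₂ ∧ y₂ ≤ 24)
    (hp : place (corner s m) l'.x l'.y = place (corner s m₂) x₂ y₂)
    (hfree : (f m₂).2.testBit (portIndex x₂ y₂ l'.dir) = false)
    (h2 : l'.on.testBit (cellIndex 2 1) = l.on.testBit (cellIndex 2 1))
    (h18 : l'.on.testBit (cellIndex 18 1) = l.on.testBit (cellIndex 18 1)) :
    ∃ c', Relation.TransGen (Step E) c c' ∧
      c'.signal = (place (corner s m₂) x₂ y₂, l'.dir) ∧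
      InLayer s a b (Function.update (Function.update f m (l'.on, l'.used)) m₂
        ((f m₂).1, addBit (f m₂).2 (portIndex x₂ y₂ l'.dir))) (afterVisit s m l'.on β) c' ∧
      ∀ s' e, s' ≤ s → c'.state (dataCell s' e) = c.state (dataCell s' e) := by
  obtain ⟨c', h3, h4, h5, h6, h7, h8⟩ := h.visit ha hb hT hin hsig hf hlow hβ hrun
    (by rw [hp, h.used m₂ ha₂ hb₂ _ _ _ hx₂.1 hx₂.2 hy₂.1 hy₂.2, hfree]; simp) h2 h18
  have hout : ∀ m', m' ≠ m₂ → c'.signal.1 ∉ window (corner s m') 24 := by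
    intro m' hm'
    rw [h4, hp]
    exact not_mem_window_of_ne' hm'.symm hx₂ hy₂
  rw [hp] at h4
  refine ⟨c', h3, h4, ⟨?_, ?_, h5.below, h5.fresh⟩, h8⟩
  · intro m' k1 k2
    by_cases e2 : m' = m₂
    · subst e2
      rw [Function.update_self]
      exact h6 m' k1 k2 hne
    · rw [Function.update_of_ne e2]
      by_cases e1 : m' = m
      · subst e1
        rw [Function.update_self]
        exact h5.state m' le_rfl le_rfl
      · rw [Function.update_of_ne e1]
        exact h6 m' k1 k2 e1
  · intro m' k1 k2
    by_cases e2 : m' = m₂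
    · subst e2
      rw [Function.update_self]
      exact usedIs_addBit (by omega) h4 (h7 m' k1 k2 hne)
    · rw [Function.update_of_ne e2]
      by_cases e1 : m' = m
      · subst e1
        rw [Function.update_self]
        exact h5.used m' le_rfl le_rfl
      · rw [Function.update_of_ne e1]
        exact usedIs_of_signal_outside (hout m' e2) (h7 m' k1 k2 e1)

theorem inputs_shiftRight (l r v : Bool) : inputs l r v >>> 1600 = 0 := by
  cases l <;> cases r <;> cases v <;> decide +kernel

theorem testBit_inputs_left (l r v : Bool) : (inputs l r v).testBit (cellIndex 2 1) = l := by
  cases l <;> cases r <;> cases v <;> decide +kernel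

theorem testBit_inputs_right (l r v : Bool) : (inputs l r v).testBit (cellIndex 18 1) = r := by
  cases l <;> cases r <;> cases v <;> decide +kernel

/-- The signal is at the start of layer `s`, in window `hi`; this layer and the layers below are
unused, and the bits `X` and the flags `v` are stored in layer `s`. -/
structure AtLayer (s hi : ℤ) (X v : ℤ → Bool) (c : Config) : Prop where
  signal : c.signal = (place (corner s hi) 11 1, .south)
  signal_used : c.signal ∈ c.used
  state : ∀ z : Cell, z.2 ≤ -24 * s → (c.state z = true ↔
    (∃ e, z = dataCell s e ∧ X e = true) ∨ ∃ m, z = flagCell s m ∧ v m = true)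
  fresh : ∀ p : Port, p.1.2 ≤ -24 * s → p ∈ c.used → p = c.signal

/-- The states of boxes below layer `s` after the windows before `m` have been passed. -/
def partialRow (s m : ℤ) (Y v : ℤ → Bool) (z : Cell) : Prop :=
  (∃ e, e < 2 * m + s ∧ z = dataCell (s + 1) e ∧ Y e = true) ∨
    ∃ m', m' < m ∧ z = flagCell (s + 1) m' ∧ v m' = true

theorem not_partialRow {s m : ℤ} {Y v : ℤ → Bool} {x : ℕ} (hx : 1 ≤ x) (hx' : x ≤ 32) :
    ¬ partialRow s m Y v (place (corner s m) x 25) := by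
  rintro (⟨e, h1, h2, -⟩ | ⟨m', h1, h2, -⟩)
  · have := (place_corner_below_eq_dataCell ⟨hx, hx'⟩).1 h2; omega
  · have := (place_corner_below_eq_flagCell ⟨hx, hx'⟩).1 h2; omega

theorem afterVisit_partialRow {s m : ℤ} {Y v : ℤ → Bool} {on : ℕ}
    (hon : on >>> 1600 = outputs (Y (2 * m + s)) (Y (2 * m + s + 1)) (v m)) (z : Cell) :
    afterVisit s m on (partialRow s m Y v) z ↔ partialRow s (m + 1) Y v z := by
  constructor
  · rintro ((⟨e, h1, h2⟩ | ⟨m', h1, h2⟩) | ⟨x, h1, h2, rfl, h3⟩)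
    · exact Or.inl ⟨e, by omega, h2⟩
    · exact Or.inr ⟨m', by omega, h2⟩
    · rw [testBit_row_below hon, testBit_outputs] at h3
      rcases h3 with ⟨rfl, h⟩ | ⟨rfl, h⟩ | ⟨rfl, h⟩
      · exact Or.inl ⟨_, by omega, (place_corner_below_eq_dataCell ⟨h1, h2⟩).2
          ⟨rfl, Or.inl ⟨rfl, rfl⟩⟩, h⟩
      · exact Or.inl ⟨_, by omega, (place_corner_below_eq_dataCell ⟨h1, h2⟩).2
          ⟨rfl, Or.inr ⟨rfl, rfl⟩⟩, h⟩
      · exact Or.inr ⟨m, by omega, (place_corner_below_eq_flagCell ⟨h1, h2⟩).2 ⟨rfl, rfl, rfl⟩, h⟩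
  · rintro (⟨e, h1, rfl, h⟩ | ⟨m', h1, rfl, h⟩)
    · by_cases he : e < 2 * m + s
      · exact Or.inl (Or.inl ⟨e, he, rfl, h⟩)
      · right
        obtain rfl | rfl : e = 2 * m + s ∨ e = 2 * m + s + 1 := by omega
        · refine ⟨2, by omega, by omega, ?_, ?_⟩
          · exact ((place_corner_below_eq_dataCell (by omega)).2 ⟨rfl, Or.inl ⟨rfl, rfl⟩⟩).symm
          · rw [testBit_row_below hon, testBit_outputs]; simp [h]
        · refine ⟨18, by omega, by omega, ?_, ?_⟩
          · exact ((place_corner_below_eq_dataCell (by omega)).2 ⟨rfl, Or.inr ⟨rfl, rfl⟩⟩).symm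
          · rw [testBit_row_below hon, testBit_outputs]; simp [h]
    · by_cases he : m' < m
      · exact Or.inl (Or.inr ⟨m', he, rfl, h⟩)
      · right
        obtain rfl : m' = m := by omega
        refine ⟨24, by omega, by omega, ?_, ?_⟩
        · exact ((place_corner_below_eq_flagCell (by omega)).2 ⟨rfl, rfl, rfl⟩).symm
        · rw [testBit_row_below hon, testBit_outputs]; simp [h]

/-! ### The passage of the signal through one layer -/

section Layer

variable {E : Diagram} {s lo hi : ℤ} {T : ℤ → List (List Tile)} {X Y v v' : ℤ → Bool}

/-- States of the boxes of window `m` of layer `s`, before it is visited. -/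
def initialOn (s : ℤ) (X v : ℤ → Bool) (m : ℤ) : ℕ :=
  inputs (X (2 * m + s)) (X (2 * m + s + 1)) (v m)

/-- How the windows of layer `s` are entered when they are visited first. -/
def firstIn (s hi : ℤ) (X v : ℤ → Bool) (m : ℤ) : Local :=
  if m = hi then startIn (initialOn s X v m) else sweepIn (initialOn s X v m)

/-- Windows of layer `s` when the signal enters window `m` from the east. -/
def sweepStage (s hi : ℤ) (T : ℤ → List (List Tile)) (X v : ℤ → Bool) (m m' : ℤ) : ℕ × ℕ :=
  if m < m' then
    ((swept (T m') (firstIn s hi X v m')).on, (swept (T m') (firstIn s hi X v m')).used)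
  else (initialOn s X v m', if m' = m then addBit 0 (portIndex 32 2 .west) else 0)

/-- Windows of layer `s` when the signal enters window `m` from the west. -/
def backStage (s hi : ℤ) (T : ℤ → List (List Tile)) (X v : ℤ → Bool) (m m' : ℤ) : ℕ × ℕ :=
  ((swept (T m') (firstIn s hi X v m')).on,
    if m' = m then addBit (swept (T m') (firstIn s hi X v m')).used (portIndex 1 3 .east)
    else (swept (T m') (firstIn s hi X v m')).used)

/-- What the windows of layer `s` do. -/
structure LayerWorks (s lo hi : ℤ) (T : ℤ → List (List Tile)) (X Y v v' : ℤ → Bool) : Prop where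
  lt : lo < hi
  start : Passable (T hi) (startIn (initialOn s X v hi)) 27 25 .south (X (2 * hi + s))
    (X (2 * hi + s + 1)) (Y (2 * hi + s)) (Y (2 * hi + s + 1)) (v' hi) = true
  through : ∀ m, lo < m → m < hi → Passable (T m) (sweepIn (initialOn s X v m)) 33 3 .east
    (X (2 * m + s)) (X (2 * m + s + 1)) (Y (2 * m + s)) (Y (2 * m + s + 1)) (v' m) = true
  turn : leavesBy ((sweepIn (initialOn s X v lo)).run (T lo) fuel) 33 3 .east
    (finished (X (2 * lo + s)) (X (2 * lo + s + 1)) (Y (2 * lo + s)) (Y (2 * lo + s + 1))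
      (v' lo)) = true
  zero_left : ∀ e, e < 2 * lo + s → Y e = false
  zero_right : ∀ e, 2 * hi + s + 2 ≤ e → Y e = false
  flag_left : ∀ m, m < lo → v' m = false
  flag_right : ∀ m, hi < m → v' m = false

theorem LayerWorks.passable (w : LayerWorks s lo hi T X Y v v') {m : ℤ} (h1 : lo < m)
    (h2 : m ≤ hi) :
    ∃ x y d, ((m < hi ∧ x = 33 ∧ y = 3 ∧ d = .east) ∨ (m = hi ∧ x = 27 ∧ y = 25 ∧ d = .south)) ∧
      Passable (T m) (firstIn s hi X v m) x y d (X (2 * m + s)) (X (2 * m + s + 1))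
        (Y (2 * m + s)) (Y (2 * m + s + 1)) (v' m) = true := by
  rcases h2.lt_or_eq with h | rfl
  · refine ⟨33, 3, .east, Or.inl ⟨h, rfl, rfl, rfl⟩, ?_⟩
    rw [firstIn, if_neg h.ne]
    exact w.through m h1 h
  · refine ⟨27, 25, .south, Or.inr ⟨rfl, rfl, rfl, rfl⟩, ?_⟩
    rw [firstIn, if_pos rfl]
    exact w.start

theorem LayerWorks.swept_spec (w : LayerWorks s lo hi T X Y v v') {m : ℤ} (h1 : lo < m)
    (h2 : m ≤ hi) :
    ∃ a, swept (T m) (firstIn s hi X v m) = a ∧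
      (firstIn s hi X v m).run (T m) fuel = some a ∧ a.x = 0 ∧ a.y = 2 ∧ a.dir = .west ∧
      a.on.testBit (cellIndex 2 1) = X (2 * m + s) ∧
      a.on.testBit (cellIndex 18 1) = X (2 * m + s + 1) ∧ a.on >>> 1600 = 0 ∧
      a.used.testBit (portIndex 1 3 .east) = false ∧
      ∃ b, (backIn a).run (T m) fuel = some b ∧
        ((m < hi ∧ b.x = 33 ∧ b.y = 3 ∧ b.dir = .east) ∨
          (m = hi ∧ b.x = 27 ∧ b.y = 25 ∧ b.dir = .south)) ∧
        b.on.testBit (cellIndex 2 1) = X (2 * m + s) ∧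
        b.on.testBit (cellIndex 18 1) = X (2 * m + s + 1) ∧
        b.on >>> 1600 = outputs (Y (2 * m + s)) (Y (2 * m + s + 1)) (v' m) := by
  obtain ⟨x, y, d, hxyd, hp⟩ := w.passable h1 h2
  obtain ⟨a, ha, hax, hay, had, hp'⟩ := leavesBy_iff.1 hp
  rw [Bool.and_eq_true, half_iff, leavesBy_iff] at hp'
  obtain ⟨⟨k1, k2, k3, k4⟩, b, hb, rfl, rfl, rfl, hq⟩ := hp'
  exact ⟨a, by rw [swept, ha]; rfl, ha, hax, hay, had, k1, k2, k3, k4, b, hb, hxyd,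
    finished_iff.1 hq⟩

/-- The places of the signal on its way west. -/
def Sweeping (s lo hi : ℤ) (T : ℤ → List (List Tile)) (X v : ℤ → Bool) (m : ℤ) (c : Config) :
    Prop :=
  c.signal = (place (corner s m) 32 2, .west) ∧
    InLayer s lo hi (sweepStage s hi T X v m) (fun _ => False) c

/-- The places of the signal on its way back to the east. -/
def Returning (s hi : ℤ) (T : ℤ → List (List Tile)) (X Y v v' : ℤ → Bool) (m : ℤ)
    (c : Config) : Prop :=
  c.signal = (place (corner s m) 1 3, .east) ∧
    InLayer s m hi (backStage s hi T X v m) (partialRow s m Y v') c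

/-- The signal goes from `c` to `c'`, and the bits in layer `s` and above are unchanged. -/
def Goes (E : Diagram) (s : ℤ) (c c' : Config) : Prop :=
  Relation.TransGen (Step E) c c' ∧
    ∀ s' e, s' ≤ s → c'.state (dataCell s' e) = c.state (dataCell s' e)

theorem Goes.trans {c₁ c₂ c₃ : Config} (h : Goes E s c₁ c₂) (h' : Goes E s c₂ c₃) :
    Goes E s c₁ c₃ :=
  ⟨h.1.trans h'.1, fun s' e hs => (h'.2 s' e hs).trans (h.2 s' e hs)⟩

theorem place_west (s m : ℤ) : place (corner s m) 0 2 = place (corner s (m - 1)) 32 2 := by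
  refine Prod.ext ?_ rfl
  simp only [place, corner]
  push_cast
  ring

theorem place_east (s m : ℤ) : place (corner s m) 33 3 = place (corner s (m + 1)) 1 3 := by
  refine Prod.ext ?_ rfl
  simp only [place, corner]
  push_cast
  ring

theorem place_south (s m : ℤ) : place (corner s m) 27 25 = place (corner (s + 1) m) 11 1 := by
  simp only [place, corner, Prod.mk.injEq]; omega

theorem InLayer.of_atLayer {c : Config} (h : AtLayer s hi X v c) (lo : ℤ) :
    InLayer s lo hi (fun m => (initialOn s X v m,
      if m = hi then addBit 0 (portIndex 11 1 .south) else 0)) (fun _ => False) c := by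
  refine ⟨?_, ?_, ?_, ?_⟩
  · intro m _ _ x y h1 h2 h3 h4
    rw [Bool.eq_iff_iff, h.state _ (by simp only [place, corner]; omega), initialOn,
      testBit_inputs _ _ _ (by omega)]
    constructor
    · rintro (⟨e, he, hX⟩ | ⟨m', he, hv⟩)
      · obtain ⟨-, rfl, ⟨rfl, rfl⟩ | ⟨rfl, rfl⟩⟩ :=
          (place_corner_eq_dataCell ⟨h1, h2⟩ ⟨h3, h4⟩).1 he
        · exact ⟨rfl, Or.inl ⟨rfl, hX⟩⟩
        · exact ⟨rfl, Or.inr (Or.inl ⟨rfl, hX⟩)⟩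
      · obtain ⟨-, rfl, rfl, rfl⟩ := (place_corner_eq_flagCell ⟨h1, h2⟩ ⟨h3, h4⟩).1 he
        exact ⟨rfl, Or.inr (Or.inr ⟨rfl, hv⟩)⟩
    · rintro ⟨rfl, ⟨rfl, hX⟩ | ⟨rfl, hX⟩ | ⟨rfl, hv⟩⟩
      · exact Or.inl ⟨_, (place_corner_eq_dataCell ⟨h1, h2⟩ ⟨h3, h4⟩).2
          ⟨rfl, rfl, Or.inl ⟨rfl, rfl⟩⟩, hX⟩
      · exact Or.inl ⟨_, (place_corner_eq_dataCell ⟨h1, h2⟩ ⟨h3, h4⟩).2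
          ⟨rfl, rfl, Or.inr ⟨rfl, rfl⟩⟩, hX⟩
      · exact Or.inr ⟨_, (place_corner_eq_flagCell ⟨h1, h2⟩ ⟨h3, h4⟩).2 ⟨rfl, rfl, rfl, rfl⟩, hv⟩
  · intro m _ _
    by_cases hm : m = hi
    · subst hm
      simp only [if_true]
      refine usedIs_addBit (by norm_num) h.signal fun x y d h1 h2 h3 h4 => ?_
      rw [Nat.zero_testBit]
      simp only [Bool.false_eq_true, false_or]
      exact ⟨h.fresh _ (by simp only [place, corner]; omega), fun k => k ▸ h.signal_used⟩
    · simp only [if_neg hm]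
      intro x y d h1 h2 h3 h4
      simp only [Nat.zero_testBit, Bool.false_eq_true, iff_false]
      intro k
      have := h.fresh _ (by simp only [place, corner]; omega) k
      rw [h.signal] at this
      simp only [place, corner, Prod.mk.injEq] at this
      omega
  · intro z hz
    rw [h.state z (by simp only [floor] at hz; omega)]
    simp only [iff_false]
    rintro (⟨e, rfl, -⟩ | ⟨m, rfl, -⟩)
    · simp only [dataCell, floor] at hz; omega
    · simp only [flagCell, floor] at hz; omega
  · intro p hp
    exact h.fresh p (by simp only [floor] at hp; omega)

theorem afterVisit_false {m : ℤ} {on : ℕ} (hon : on >>> 1600 = 0) (z : Cell) :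
    afterVisit s m on (fun _ => False) z ↔ False := by
  simp [afterVisit, testBit_row_below hon]

theorem LayerWorks.sweep_start (w : LayerWorks s lo hi T X Y v v')
    (hT : ∀ m, Shows E (corner s m) (T m)) {c : Config} (h : AtLayer s hi X v c) :
    ∃ c', Goes E s c c' ∧ Sweeping s lo hi T X v (hi - 1) c' := by
  have hlt := w.lt
  obtain ⟨a, ha, hrun, hx, hy, hd, h2, h18, hlow, -⟩ := w.swept_spec hlt le_rfl
  have hfi : firstIn s hi X v hi = startIn (initialOn s X v hi) := if_pos rfl
  obtain ⟨c', k1, k2, k3, k4⟩ := (InLayer.of_atLayer h lo).visit_move (m := hi) (m₂ := hi - 1)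
    hlt.le le_rfl (by omega) (by omega) (by omega) (hT hi) (l := firstIn s hi X v hi)
    (by rw [hfi]; rfl) (by rw [hfi]; exact h.signal) (by simp [hfi, startIn])
    (by rw [hfi]; exact inputs_shiftRight _ _ _) (fun _ _ _ => id) hrun (x₂ := 32) (y₂ := 2)
    (by omega) (by omega) (by rw [hx, hy]; exact place_west s hi) (by simp)
    (by rw [h2, hfi]; exact (testBit_inputs_left _ _ _).symm)
    (by rw [h18, hfi]; exact (testBit_inputs_right _ _ _).symm)
  rw [hd] at k2
  refine ⟨c', ⟨k1, k4⟩, k2, k3.mono le_rfl le_rfl ?_ fun z _ => afterVisit_false hlow z⟩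
  intro m' h1 h3
  simp only [sweepStage]
  by_cases e1 : m' = hi - 1
  · subst e1
    simp [hd]
  · rw [Function.update_of_ne e1]
    by_cases e2 : m' = hi
    · subst e2
      rw [Function.update_self, if_pos (by omega), ha]
    · rw [Function.update_of_ne e2, if_neg e2, if_neg (by omega), if_neg e1]

theorem LayerWorks.sweep_step (w : LayerWorks s lo hi T X Y v v')
    (hT : ∀ m, Shows E (corner s m) (T m)) {c : Config} {m : ℤ} (h1 : lo < m) (h2 : m < hi)
    (h : Sweeping s lo hi T X v m c) :
    ∃ c', Goes E s c c' ∧ Sweeping s lo hi T X v (m - 1) c' := by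
  obtain ⟨a, ha, hrun, hx, hy, hd, k2, k18, hlow, -⟩ := w.swept_spec h1 h2.le
  have hfi : firstIn s hi X v m = sweepIn (initialOn s X v m) := if_neg h2.ne
  obtain ⟨c', g1, g2, g3, g4⟩ := h.2.visit_move (m := m) (m₂ := m - 1)
    h1.le h2.le (by omega) (by omega) (by omega) (hT m) (l := firstIn s hi X v m)
    (by rw [hfi]; rfl) (by rw [hfi]; exact h.1) (by simp [hfi, sweepStage, sweepIn])
    (by rw [hfi]; exact inputs_shiftRight _ _ _) (fun _ _ _ => id) hrun (x₂ := 32) (y₂ := 2)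
    (by omega) (by omega) (by rw [hx, hy]; exact place_west s m)
    (by simp [sweepStage, show ¬ m < m - 1 by omega])
    (by rw [k2, hfi]; exact (testBit_inputs_left _ _ _).symm)
    (by rw [k18, hfi]; exact (testBit_inputs_right _ _ _).symm)
  rw [hd] at g2
  refine ⟨c', ⟨g1, g4⟩, g2, g3.mono le_rfl le_rfl ?_ fun z _ => afterVisit_false hlow z⟩
  intro m' _ _
  by_cases e1 : m' = m - 1
  · subst e1
    simp [hd, sweepStage, show ¬ m < m - 1 by omega]
  · rw [Function.update_of_ne e1]
    by_cases e2 : m' = m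
    · subst e2
      rw [Function.update_self, sweepStage, if_pos (by omega), ha]
    · rw [Function.update_of_ne e2]
      simp only [sweepStage, if_neg e1, if_neg e2, show m < m' ↔ m - 1 < m' by omega]

theorem LayerWorks.sweep (w : LayerWorks s lo hi T X Y v v')
    (hT : ∀ m, Shows E (corner s m) (T m)) {c : Config} (h : AtLayer s hi X v c) (k : ℕ)
    (hk : lo ≤ hi - 1 - k) :
    ∃ c', Goes E s c c' ∧ Sweeping s lo hi T X v (hi - 1 - k) c' := by
  induction k with
  | zero => simpa using w.sweep_start hT h
  | succ k ih =>
    obtain ⟨c₁, h1, h2⟩ := ih (by omega)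
    obtain ⟨c₂, h3, h4⟩ := w.sweep_step hT (by push_cast at hk; omega) (by omega) h2
    refine ⟨c₂, h1.trans h3, ?_⟩
    rwa [show hi - 1 - ((k + 1 : ℕ) : ℤ) = hi - 1 - k - 1 by push_cast; ring]

theorem LayerWorks.turn_back (w : LayerWorks s lo hi T X Y v v')
    (hT : ∀ m, Shows E (corner s m) (T m)) {c : Config} (h : Sweeping s lo hi T X v lo c) :
    ∃ c', Goes E s c c' ∧ Returning s hi T X Y v v' (lo + 1) c' := by
  have hlt := w.lt
  obtain ⟨b, hrun, hx, hy, hd, hp⟩ := leavesBy_iff.1 w.turn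
  obtain ⟨k2, k18, hout⟩ := finished_iff.1 hp
  obtain ⟨a, ha, -, -, -, -, -, -, -, hfree, -⟩ := w.swept_spec (m := lo + 1) (by omega) (by omega)
  obtain ⟨c', g1, g2, g3, g4⟩ := h.2.visit_move (m := lo) (m₂ := lo + 1)
    le_rfl hlt.le (by omega) (by omega) (by omega) (hT lo) (l := sweepIn (initialOn s X v lo))
    rfl h.1 (by simp [sweepStage, sweepIn]) (inputs_shiftRight _ _ _) (fun _ _ _ => id) hrun
    (x₂ := 1) (y₂ := 3) (by omega) (by omega) (by rw [hx, hy]; exact place_east s lo)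
    (by simp only [sweepStage, if_pos (show lo < lo + 1 by omega), ha, hd]; exact hfree)
    (by rw [k2]; exact (testBit_inputs_left _ _ _).symm)
    (by rw [k18]; exact (testBit_inputs_right _ _ _).symm)
  rw [hd] at g2
  refine ⟨c', ⟨g1, g4⟩, g2, g3.mono (by omega) le_rfl ?_ fun z hz => ?_⟩
  · intro m' h1 h2
    by_cases e1 : m' = lo + 1
    · subst e1
      simp [hd, sweepStage, backStage]
    · rw [Function.update_of_ne e1, Function.update_of_ne (by omega), sweepStage, backStage,
        if_pos (by omega), if_neg e1]
  · rw [← afterVisit_partialRow hout]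
    -- West of window `lo` nothing has been written, which is correct because the new bits and flags
    -- vanish there.
    simp only [afterVisit]
    refine or_congr_left ?_
    rw [false_iff]
    rintro (⟨e, h1, rfl, h2⟩ | ⟨m', h1, rfl, h2⟩)
    · rw [w.zero_left e h1] at h2; cases h2
    · rw [w.flag_left m' h1] at h2; cases h2

theorem LayerWorks.back_step (w : LayerWorks s lo hi T X Y v v')
    (hT : ∀ m, Shows E (corner s m) (T m)) {c : Config} {m : ℤ} (h1 : lo < m) (h2 : m < hi)
    (h : Returning s hi T X Y v v' m c) :
    ∃ c', Goes E s c c' ∧ Returning s hi T X Y v v' (m + 1) c' := by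
  obtain ⟨a, ha, -, -, -, -, k2, k18, hlow, -, b, hrun, hb, q2, q18, hout⟩ := w.swept_spec h1 h2.le
  obtain ⟨a', ha', -, -, -, -, -, -, -, hfree, -⟩ :=
    w.swept_spec (m := m + 1) (by omega) (by omega)
  obtain ⟨-, hx, hy, hd⟩ | ⟨hm, -⟩ := hb
  swap
  · omega
  obtain ⟨c', g1, g2, g3, g4⟩ := h.2.visit_move (m := m) (m₂ := m + 1)
    le_rfl h2.le (by omega) (by omega) (by omega) (hT m) (l := backIn a)
    rfl h.1 (by simp [backStage, backIn, ha]) hlow (fun _ k1 k2 => not_partialRow k1 k2) hrun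
    (x₂ := 1) (y₂ := 3) (by omega) (by omega) (by rw [hx, hy]; exact place_east s m)
    (by simp only [backStage, if_neg (show m + 1 ≠ m by omega), ha', hd]; exact hfree)
    (by rw [q2]; exact k2.symm) (by rw [q18]; exact k18.symm)
  rw [hd] at g2
  refine ⟨c', ⟨g1, g4⟩, g2, g3.mono (by omega) le_rfl ?_ fun z _ => afterVisit_partialRow hout z⟩
  intro m' h3 h4
  by_cases e1 : m' = m + 1
  · subst e1
    simp [hd, backStage]
  · rw [Function.update_of_ne e1, Function.update_of_ne (by omega), backStage, backStage,
      if_neg (by omega), if_neg e1]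

theorem LayerWorks.back (w : LayerWorks s lo hi T X Y v v')
    (hT : ∀ m, Shows E (corner s m) (T m)) {c : Config}
    (h : Returning s hi T X Y v v' (lo + 1) c) (k : ℕ) (hk : lo + 1 + k ≤ hi) :
    ∃ c', Relation.ReflGen (Goes E s) c c' ∧ Returning s hi T X Y v v' (lo + 1 + k) c' := by
  induction k with
  | zero => exact ⟨c, .refl, by simpa using h⟩
  | succ k ih =>
    obtain ⟨c₁, h1, h2⟩ := ih (by push_cast at hk; omega)
    obtain ⟨c₂, h3, h4⟩ := w.back_step hT (by omega) (by push_cast at hk; omega) h2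
    refine ⟨c₂, .single ?_, ?_⟩
    · cases h1 with
      | refl => exact h3
      | single h1 => exact h1.trans h3
    · rwa [show lo + 1 + ((k + 1 : ℕ) : ℤ) = lo + 1 + k + 1 by push_cast; ring]

theorem LayerWorks.finish (w : LayerWorks s lo hi T X Y v v')
    (hT : ∀ m, Shows E (corner s m) (T m)) {c : Config}
    (h : Returning s hi T X Y v v' hi c) :
    ∃ c', Goes E s c c' ∧ AtLayer (s + 1) hi Y v' c' := by
  have hlt := w.lt
  obtain ⟨a, ha, -, -, -, -, k2, k18, hlow, -, b, hrun, hb, q2, q18, hout⟩ :=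
    w.swept_spec hlt le_rfl
  obtain ⟨hm, -⟩ | ⟨-, hx, hy, hd⟩ := hb
  · omega
  -- The exit port lies below the layer, where no port but that of the signal itself could have been
  -- used.
  have hnew : (place (corner s hi) b.x b.y, b.dir) ∉ c.used := by
    intro k
    have := h.2.fresh _ (by rw [hx, hy]; simp only [place, corner, floor]; omega) k
    rw [h.1, hx, hy] at this
    simp only [place, corner, Prod.mk.injEq] at this
    omega
  obtain ⟨c', g1, g2, g3, -, -, g4⟩ := h.2.visit (m := hi)
    le_rfl le_rfl (hT hi) (l := backIn a)
    rfl h.1 (by simp [backStage, backIn, ha]) hlow (fun _ k1 k2 => not_partialRow k1 k2) hrun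
    hnew (by rw [q2]; exact k2.symm) (by rw [q18]; exact k18.symm)
  rw [hx, hy, hd, place_south] at g2
  refine ⟨c', ⟨g1, g4⟩, g2, ?_, fun z hz => ?_, fun p hp => g3.fresh p hp⟩
  · obtain ⟨c₀, -, o, t, -, -, rfl⟩ := Relation.TransGen.tail'_iff.1 g1
    exact Set.mem_insert _ _
  · rw [g3.below z hz]
    refine (afterVisit_partialRow hout z).trans (or_congr ?_ ?_)
    · refine exists_congr fun e => ⟨fun k => k.2, fun k => ⟨?_, k⟩⟩
      by_contra h3
      rw [w.zero_right e (by omega)] at k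
      cases k.2
    · refine exists_congr fun m' => ⟨fun k => k.2, fun k => ⟨?_, k⟩⟩
      by_contra h3
      rw [w.flag_right m' (by omega)] at k
      cases k.2

/-- The signal passes through a layer. -/
theorem LayerWorks.run (w : LayerWorks s lo hi T X Y v v')
    (hT : ∀ m, Shows E (corner s m) (T m)) {c : Config} (h : AtLayer s hi X v c) :
    ∃ c', Goes E s c c' ∧ AtLayer (s + 1) hi Y v' c' := by
  have hlt := w.lt
  obtain ⟨c₁, h1, h1'⟩ := w.sweep hT h (hi - 1 - lo).toNat (by omega)
  rw [show hi - 1 - ((hi - 1 - lo).toNat : ℤ) = lo by omega] at h1'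
  obtain ⟨c₂, h2, h2'⟩ := w.turn_back hT h1'
  obtain ⟨c₃, h3, h3'⟩ := w.back hT h2' (hi - 1 - lo).toNat (by omega)
  rw [show lo + 1 + ((hi - 1 - lo).toNat : ℤ) = hi by omega] at h3'
  obtain ⟨c₄, h4, h4'⟩ := w.finish hT h3'
  refine ⟨c₄, ?_, h4'⟩
  cases h3 with
  | refl => exact (h1.trans h2).trans h4
  | single h3 => exact ((h1.trans h2).trans h3).trans h4

end Layer

/-! ## The diagram -/

/-- The table of a window: `none` stands for a window where the signal can turn. -/
def tableOf : Option Gate → List (List Tile)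
  | none => Glyph.turnTable
  | some g => g.table

def isRead : Tile → Bool
  | .boxRead u _ => u.beq .north
  | _ => false

def isWrite : Tile → Bool
  | .boxWrite u => u.beq .north
  | _ => false

/-- Columns of the boxes that reach into the row above a window. -/
def topColumn (x : ℕ) : Bool := Nat.beq x 2 || Nat.beq x 18 || Nat.beq x 8

/-- Columns of the boxes that reach into the row below a window. -/
def bottomColumn (x : ℕ) : Bool := Nat.beq x 2 || Nat.beq x 18 || Nat.beq x 24

/-- Local conditions on the tile in column `x` and row `y`. -/
def tileOk (T : List (List Tile)) (x y : ℕ) : Bool :=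
  (match entry T x y with
    | .blank => true
    | .wire i o => !o.beq i.opp
    | .union i j o => !i.beq j && !o.beq i.opp && !o.beq j.opp
    | .cross i j => j.beq i.right || j.beq i.left
    | .boxRead u _ => u.beq .north &&
        bif Nat.beq y 1 then topColumn x else isWrite (entry T x (y - 1))
    | .boxWrite u => u.beq .north &&
        bif Nat.beq y 24 then bottomColumn x else isRead (entry T x (y + 1))) &&
  (!(Nat.beq y 1 && topColumn x) || isRead (entry T x y)) &&
  (!(Nat.beq y 24 && bottomColumn x) || isWrite (entry T x y))

def tableOk (T : List (List Tile)) : Bool :=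
  (List.range 32).all fun x => (List.range 24).all fun y => tileOk T (x + 1) (y + 1)

/-- Besides well-formedness this checks that all tables have the halves of boundary boxes in the
same columns, so that windows fit together in any arrangement. -/
theorem tableOk_tableOf (k : Option Gate) : tableOk (tableOf k) = true := by
  rcases k with _ | (_ | _ | _ | _) <;> decide +kernel

theorem tileOk_tableOf (k : Option Gate) {x y : ℕ} (hx : 1 ≤ x ∧ x ≤ 32) (hy : 1 ≤ y ∧ y ≤ 24) :
    tileOk (tableOf k) x y = true := by
  have h := tableOk_tableOf k
  simp only [tableOk, List.all_eq_true, List.mem_range] at h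
  have := h (x - 1) (by omega) (y - 1) (by omega)
  rwa [Nat.sub_add_cancel hx.1, Nat.sub_add_cancel hy.1] at this

theorem isRead_iff {t : Tile} : isRead t = true ↔ ∃ s, t = .boxRead .north s := by
  cases t <;> simp [isRead, Dir.beq_iff]

theorem isWrite_iff {t : Tile} : isWrite t = true ↔ t = .boxWrite .north := by
  cases t <;> simp [isWrite, Dir.beq_iff]

theorem topColumn_iff {x : ℕ} : topColumn x = true ↔ x = 2 ∨ x = 18 ∨ x = 8 := by
  simp [topColumn, or_assoc]

theorem bottomColumn_iff {x : ℕ} : bottomColumn x = true ↔ x = 2 ∨ x = 18 ∨ x = 24 := by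
  simp [bottomColumn, or_assoc]

theorem entry_read {k : Option Gate} {x y : ℕ} (hx : 1 ≤ x ∧ x ≤ 32) (hy : 1 ≤ y ∧ y ≤ 24)
    {u : Dir} {s : Bool} (h : entry (tableOf k) x y = .boxRead u s) :
    u = .north ∧ ((y = 1 ∧ (x = 2 ∨ x = 18 ∨ x = 8)) ∨
      2 ≤ y ∧ entry (tableOf k) x (y - 1) = .boxWrite .north) := by
  have := tileOk_tableOf k hx hy
  rw [tileOk, h, Bool.and_eq_true, Bool.and_eq_true, Bool.and_eq_true, Dir.beq_iff] at this
  obtain ⟨⟨⟨rfl, h1⟩, -⟩, -⟩ := this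
  refine ⟨rfl, ?_⟩
  by_cases hy1 : y = 1
  · subst hy1; exact Or.inl ⟨rfl, topColumn_iff.1 h1⟩
  · have : Nat.beq y 1 = false := by simpa [← Bool.not_eq_true]
    rw [this, cond_false, isWrite_iff] at h1
    exact Or.inr ⟨by omega, h1⟩

theorem entry_write {k : Option Gate} {x y : ℕ} (hx : 1 ≤ x ∧ x ≤ 32) (hy : 1 ≤ y ∧ y ≤ 24)
    {u : Dir} (h : entry (tableOf k) x y = .boxWrite u) :
    u = .north ∧ ((y = 24 ∧ (x = 2 ∨ x = 18 ∨ x = 24)) ∨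
      y ≤ 23 ∧ ∃ s, entry (tableOf k) x (y + 1) = .boxRead .north s) := by
  have := tileOk_tableOf k hx hy
  rw [tileOk, h, Bool.and_eq_true, Bool.and_eq_true, Bool.and_eq_true, Dir.beq_iff] at this
  obtain ⟨⟨⟨rfl, h1⟩, -⟩, -⟩ := this
  refine ⟨rfl, ?_⟩
  by_cases hy1 : y = 24
  · subst hy1; exact Or.inl ⟨rfl, bottomColumn_iff.1 h1⟩
  · have : Nat.beq y 24 = false := by simpa [← Bool.not_eq_true]
    rw [this, cond_false, isRead_iff] at h1
    exact Or.inr ⟨by omega, h1⟩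

theorem entry_top (k : Option Gate) {x : ℕ} (hx : x = 2 ∨ x = 18 ∨ x = 8) :
    ∃ s, entry (tableOf k) x 1 = .boxRead .north s := by
  have := tileOk_tableOf k (x := x) (y := 1) (by omega) (by omega)
  rw [tileOk, Bool.and_eq_true, Bool.and_eq_true] at this
  have h := this.1.2
  rw [topColumn_iff.2 hx] at h
  exact isRead_iff.1 h

theorem entry_bottom (k : Option Gate) {x : ℕ} (hx : x = 2 ∨ x = 18 ∨ x = 24) :
    entry (tableOf k) x 24 = .boxWrite .north := by
  have := tileOk_tableOf k (x := x) (y := 24) (by omega) (by omega)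
  rw [tileOk, Bool.and_eq_true, Bool.and_eq_true] at this
  have h := this.2
  rw [bottomColumn_iff.2 hx] at h
  exact isWrite_iff.1 h

/-- Content of a cell of the diagram whose windows are given by `K` (layer and number in the
layer), with initial states of boxes `σ`. -/
def tileAt (K : ℤ → ℤ → Option Gate) (σ : Cell → Bool) (z : Cell) : Tile :=
  let s := -z.2 / 24
  (entry (tableOf (K s ((z.1 - 16 * s) / 32))) ((z.1 - 16 * s) % 32 + 1).toNat
    (-z.2 % 24 + 1).toNat).withState (σ z)

theorem tileAt_place (K : ℤ → ℤ → Option Gate) (σ : Cell → Bool) (s m : ℤ) {x y : ℕ}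
    (hx : 1 ≤ x ∧ x ≤ 32) (hy : 1 ≤ y ∧ y ≤ 24) :
    tileAt K σ (place (corner s m) x y) =
      (entry (tableOf (K s m)) x y).withState (σ (place (corner s m) x y)) := by
  have h1 : -(place (corner s m) x y).2 / 24 = s := by simp only [place, corner]; omega
  have h2 : (-(place (corner s m) x y).2 % 24 + 1).toNat = y := by
    simp only [place, corner]; omega
  have h3 : ((place (corner s m) x y).1 - 16 * s) / 32 = m := by simp only [place, corner]; omega
  have h4 : (((place (corner s m) x y).1 - 16 * s) % 32 + 1).toNat = x := by
    simp only [place, corner]; omega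
  simp only [tileAt, h1, h2, h3, h4]

theorem exists_place_corner (z : Cell) : ∃ (s m : ℤ) (x y : ℕ),
    z = place (corner s m) x y ∧ (1 ≤ x ∧ x ≤ 32) ∧ 1 ≤ y ∧ y ≤ 24 := by
  obtain ⟨z1, z2⟩ := z
  refine ⟨-z2 / 24, (z1 - 16 * (-z2 / 24)) / 32, ((z1 - 16 * (-z2 / 24)) % 32 + 1).toNat,
    (-z2 % 24 + 1).toNat, ?_, ?_, ?_⟩
  · simp only [place, corner, Prod.mk.injEq]; omega
  · omega
  · omega

theorem withState_eq_read {t : Tile} {b : Bool} {u : Dir} {s : Bool} :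
    t.withState b = .boxRead u s ↔ s = b ∧ ∃ s', t = .boxRead u s' := by
  cases t <;> (simp [Tile.withState]; try tauto)

theorem withState_eq_write {t : Tile} {b : Bool} {u : Dir} :
    t.withState b = .boxWrite u ↔ t = .boxWrite u := by
  cases t <;> simp [Tile.withState]

/-- The diagram whose windows are given by `K`, with initial states of boxes `σ`. -/
def diagram (K : ℤ → ℤ → Option Gate) (σ : Cell → Bool) : Diagram where
  tile := tileAt K σ
  wellFormed p := by
    obtain ⟨s, m, x, y, rfl, hx, hy⟩ := exists_place_corner p
    rw [tileAt_place K σ s m hx hy]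
    have h := tileOk_tableOf (K s m) hx hy
    rw [tileOk, Bool.and_eq_true, Bool.and_eq_true] at h
    have h := h.1.1
    cases he : entry (tableOf (K s m)) x y <;> rw [he] at h <;>
      simp only [Tile.withState, Tile.WellFormed]
    · simpa [← Dir.beq_iff] using h
    · simpa [← Dir.beq_iff, and_assoc] using h
    · simpa [← Dir.beq_iff] using h
  read_write p u i hp := by
    obtain ⟨s, m, x, y, rfl, hx, hy⟩ := exists_place_corner p
    rw [tileAt_place K σ s m hx hy, withState_eq_read] at hp
    obtain ⟨-, i', hp⟩ := hp
    obtain ⟨rfl, ⟨rfl, h⟩ | ⟨h2, h⟩⟩ := entry_read hx hy hp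
    -- Because of the shift by 16, columns 2, 18, 8 of the top row lie under columns 18, 2, 24 of
    -- the layer above.
    · have key : ∃ (m' : ℤ) (x' : ℕ), (x' = 2 ∨ x' = 18 ∨ x' = 24) ∧
          place (corner s m) x 1 + Dir.north.vec = place (corner (s - 1) m') x' 24 := by
        rcases h with rfl | rfl | rfl
        · exact ⟨m, 18, by omega, by simp [place, corner, Dir.vec]; omega⟩
        · exact ⟨m + 1, 2, by omega, by simp [place, corner, Dir.vec]; omega⟩
        · exact ⟨m, 24, by omega, by simp [place, corner, Dir.vec]; omega⟩
      obtain ⟨m', x', hx', he⟩ := key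
      rw [he, tileAt_place K σ _ _ (by omega) (by omega), withState_eq_write]
      exact entry_bottom _ hx'
    · have he : place (corner s m) x y + Dir.north.vec = place (corner s m) x (y - 1) := by
        simp only [place, Dir.vec, Prod.mk_add_mk, Prod.mk.injEq]; omega
      rw [he, tileAt_place K σ _ _ hx (by omega), withState_eq_write]
      exact h
  write_read p u hp := by
    obtain ⟨s, m, x, y, rfl, hx, hy⟩ := exists_place_corner p
    rw [tileAt_place K σ s m hx hy, withState_eq_write] at hp
    obtain ⟨rfl, ⟨rfl, h⟩ | ⟨h2, h⟩⟩ := entry_write hx hy hp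
    · have key : ∃ (m' : ℤ) (x' : ℕ), (x' = 2 ∨ x' = 18 ∨ x' = 8) ∧
          place (corner s m) x 24 - Dir.north.vec = place (corner (s + 1) m') x' 1 := by
        rcases h with rfl | rfl | rfl
        · exact ⟨m - 1, 18, by omega, by simp [place, corner, Dir.vec]; omega⟩
        · exact ⟨m, 2, by omega, by simp [place, corner, Dir.vec]; omega⟩
        · exact ⟨m, 8, by omega, by simp [place, corner, Dir.vec]; omega⟩
      obtain ⟨m', x', hx', he⟩ := key
      rw [he, tileAt_place K σ _ _ (by omega) (by omega)]
      obtain ⟨i, hi⟩ := entry_top (K (s + 1) m') hx'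
      exact ⟨_, withState_eq_read.2 ⟨rfl, i, hi⟩⟩
    · have he : place (corner s m) x y - Dir.north.vec = place (corner s m) x (y + 1) := by
        simp only [place, Dir.vec, Prod.mk_sub_mk, Prod.mk.injEq]; omega
      rw [he, tileAt_place K σ _ _ hx (by omega)]
      obtain ⟨i, hi⟩ := h
      exact ⟨_, withState_eq_read.2 ⟨rfl, i, hi⟩⟩

theorem diagram_shows (K : ℤ → ℤ → Option Gate) (σ : Cell → Bool) (s m : ℤ) :
    Shows (diagram K σ) (corner s m) (tableOf (K s m)) :=
  fun _ _ h1 h2 h3 h4 => ⟨_, tileAt_place K σ s m ⟨h1, h2⟩ ⟨h3, h4⟩⟩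

theorem diagram_dataCell (K : ℤ → ℤ → Option Gate) (σ : Cell → Bool) (s e : ℤ) :
    (diagram K σ).tile (dataCell s e) = .boxRead .north (σ (dataCell s e)) := by
  obtain ⟨x, hx, he⟩ : ∃ x : ℕ, (x = 2 ∨ x = 18 ∨ x = 8) ∧
      dataCell s e = place (corner s ((e - s) / 2)) x 1 := by
    obtain h | h : e = 2 * ((e - s) / 2) + s ∨ e = 2 * ((e - s) / 2) + s + 1 := by omega
    · exact ⟨2, by omega, ((place_corner_eq_dataCell (by omega) (by omega)).2
        ⟨rfl, rfl, Or.inl ⟨rfl, h⟩⟩).symm⟩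
    · exact ⟨18, by omega, ((place_corner_eq_dataCell (by omega) (by omega)).2
        ⟨rfl, rfl, Or.inr ⟨rfl, h⟩⟩).symm⟩
  rw [he]
  refine (tileAt_place K σ _ _ (by omega) (by omega)).trans ?_
  rw [withState_eq_read]
  exact ⟨rfl, entry_top _ hx⟩

theorem diagram_flagCell (K : ℤ → ℤ → Option Gate) (σ : Cell → Bool) (s m : ℤ) :
    (diagram K σ).tile (flagCell s m) = .boxRead .north (σ (flagCell s m)) := by
  rw [← (place_corner_eq_flagCell (x := 8) (y := 1) (by omega) (by omega)).2 ⟨rfl, rfl, rfl, rfl⟩]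
  refine (tileAt_place K σ _ _ (by omega) (by omega)).trans ?_
  rw [withState_eq_read]
  exact ⟨rfl, entry_top _ (by omega)⟩

theorem diagram_isPeriod {K : ℤ → ℤ → Option Gate} {a b : ℤ}
    (h : ∀ s m, K (s + a) (m + b) = K s m) :
    (diagram K fun _ => false).IsPeriod (32 * b + 16 * a, -24 * a) := by
  intro p
  obtain ⟨s, m, x, y, rfl, hx, hy⟩ := exists_place_corner p
  have he : place (corner s m) x y + (32 * b + 16 * a, -24 * a) =
      place (corner (s + a) (m + b)) x y := by
    simp only [place, corner, Prod.mk_add_mk, Prod.mk.injEq]; omega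
  rw [he]
  change tileAt K (fun _ => false) (place (corner (s + a) (m + b)) x y) =
    tileAt K (fun _ => false) (place (corner s m) x y)
  rw [tileAt_place K _ _ _ hx hy, tileAt_place K _ _ _ hx hy, h]

theorem diagram_isFiniteModification (K : ℤ → ℤ → Option Gate) {σ : Cell → Bool}
    (h : {z | σ z = true}.Finite) :
    (diagram K σ).IsFiniteModification (diagram K fun _ => false) := by
  refine h.subset fun z hz => ?_
  by_contra hσ
  refine hz ?_
  have : σ z = false := by simpa using hσ
  simp only [diagram, tileAt, this]

open Classical in
/-- Initial states of boxes, for given bits and flags in layer 0. -/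
noncomputable def initialStates (X v : ℤ → Bool) (z : Cell) : Bool :=
  decide ((∃ e, z = dataCell 0 e ∧ X e = true) ∨ ∃ m, z = flagCell 0 m ∧ v m = true)

theorem atLayer_init (K : ℤ → ℤ → Option Gate) (X v : ℤ → Bool) (hi : ℤ) :
    AtLayer 0 hi X v ((diagram K (initialStates X v)).init (place (corner 0 hi) 11 1, .south)) := by
  refine ⟨rfl, Set.mem_singleton _, fun z _ => ?_, fun p _ h => h⟩
  have h0 : initialStates X v z = true ↔
      (∃ e, z = dataCell 0 e ∧ X e = true) ∨ ∃ m, z = flagCell 0 m ∧ v m = true := by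
    simp [initialStates]
  rw [← h0]
  simp only [Diagram.init]
  constructor
  · intro h
    cases ht : (diagram K (initialStates X v)).tile z with
    | boxRead u s =>
      rw [ht] at h
      obtain ⟨h1, -⟩ := withState_eq_read.1 (show (entry _ _ _).withState _ = _ from ht)
      rw [← h1]; exact h
    | _ => rw [ht] at h; cases h
  · intro h
    have ht : (diagram K (initialStates X v)).tile z = .boxRead .north (initialStates X v z) := by
      rcases h0.1 h with ⟨e, rfl, -⟩ | ⟨m, rfl, -⟩
      · exact diagram_dataCell _ _ _ _
      · exact diagram_flagCell _ _ _ _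
    rw [ht]; exact h

/-! ## Infinite runs -/

theorem Passes.unique {D : Diagram} {c : Config} {o o' : Dir} {s s' : Cell → Bool}
    (h : Passes D c o s) (h' : Passes D c o' s') : o = o' ∧ s = s' := by
  cases h <;> cases h' <;> simp_all

/-- By determinism all finite runs are iterates of the single map `next`, and so they can be
concatenated. -/
theorem Step.unique {D : Diagram} {c c₁ c₂ : Config} (h₁ : Step D c c₁) (h₂ : Step D c c₂) :
    c₁ = c₂ := by
  obtain ⟨o, s, h, -, rfl⟩ := h₁
  obtain ⟨o', s', h', -, rfl⟩ := h₂
  obtain ⟨rfl, rfl⟩ := h.unique h'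
  rfl

theorem Passes.mono {D : Diagram} {c : Config} {o : Dir} {s : Cell → Bool} (h : Passes D c o s)
    {z : Cell} (hz : c.state z = true) : s z = true := by
  cases h
  case write =>
    rw [Function.update_apply]
    split_ifs
    · rfl
    · exact hz
  all_goals exact hz

/-- No rule resets a box. It follows that a box found in state 0 at some moment was in state 0 at
all earlier ones. -/
theorem Step.mono {D : Diagram} {c c' : Config} (h : Step D c c') {z : Cell}
    (hz : c.state z = true) : c'.state z = true := by
  obtain ⟨o, s, h, -, rfl⟩ := h
  exact h.mono hz

open Classical in
/-- The next situation. -/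
noncomputable def next (D : Diagram) (c : Config) : Config :=
  if h : ∃ c', Step D c c' then h.choose else c

theorem next_eq {D : Diagram} {c c' : Config} (h : Step D c c') : next D c = c' := by
  have h' : ∃ c', Step D c c' := ⟨c', h⟩
  rw [next, dif_pos h']
  exact h'.choose_spec.unique h

theorem exists_iterate_next {D : Diagram} {c c' : Config} (h : Relation.TransGen (Step D) c c') :
    ∃ n, 0 < n ∧ (next D)^[n] c = c' ∧
      ∀ k, k < n → Step D ((next D)^[k] c) ((next D)^[k + 1] c) := by
  induction h using Relation.TransGen.head_induction_on with
  | single h =>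
    refine ⟨1, one_pos, next_eq h, fun k hk => ?_⟩
    obtain rfl : k = 0 := by omega
    simpa [next_eq h] using h
  | head h _ ih =>
    obtain ⟨n, -, h2, h3⟩ := ih
    refine ⟨n + 1, by omega, by rw [Function.iterate_succ_apply, next_eq h, h2], fun k hk => ?_⟩
    cases k with
    | zero => simpa [next_eq h] using h
    | succ k =>
      rw [Function.iterate_succ_apply, Function.iterate_succ_apply _ (k + 1), next_eq h]
      exact h3 k (by omega)

/-- Joining finite runs to an infinite one. -/
theorem exists_infinite_run {D : Diagram} {C : ℕ → Config}
    (h : ∀ n, Relation.TransGen (Step D) (C n) (C (n + 1))) :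
    ∃ (ρ : ℕ → Config) (τ : ℕ → ℕ), (∀ n, Step D (ρ n) (ρ (n + 1))) ∧ τ 0 = 0 ∧ StrictMono τ ∧
      ∀ n, ρ (τ n) = C n := by
  choose len hpos hlen hstep using fun n => exists_iterate_next (h n)
  have hτ : ∀ n, (next D)^[∑ i ∈ Finset.range n, len i] (C 0) = C n := by
    intro n
    induction n with
    | zero => rfl
    | succ n ih => rw [Finset.sum_range_succ, add_comm, Function.iterate_add_apply, ih, hlen]
  have hmono : StrictMono fun n => ∑ i ∈ Finset.range n, len i := by
    refine strictMono_nat_of_lt_succ fun n => ?_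
    rw [Finset.sum_range_succ]
    exact Nat.lt_add_of_pos_right (hpos n)
  refine ⟨fun k => (next D)^[k] (C 0), _, fun k => ?_, Finset.sum_range_zero _, hmono, hτ⟩
  obtain ⟨n, h1, h2⟩ : ∃ n, ∑ i ∈ Finset.range n, len i ≤ k ∧
      k < ∑ i ∈ Finset.range (n + 1), len i := by
    by_contra hcon
    push Not at hcon
    have : ∀ n, ∑ i ∈ Finset.range n, len i ≤ k := by
      intro n
      induction n with
      | zero => simp
      | succ n ih => exact hcon n ih
    -- A strictly increasing sequence of naturals is at least `k + 1` at the index `k + 1`, so it is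
    -- not bounded by `k`.
    exact absurd (hmono.le_apply (x := k + 1)) (by have := this (k + 1); omega)
  obtain ⟨j, rfl⟩ := Nat.exists_eq_add_of_le h1
  rw [Finset.sum_range_succ] at h2
  have := hstep n j (by omega)
  rw [← hτ n, ← Function.iterate_add_apply, ← Function.iterate_add_apply] at this
  rwa [show j + ∑ i ∈ Finset.range n, len i = ∑ i ∈ Finset.range n, len i + j by omega,
    show j + 1 + ∑ i ∈ Finset.range n, len i = ∑ i ∈ Finset.range n, len i + j + 1 by omega] at this

/-! ## Runs through all layers -/

/-- The action of a window on its two bits. -/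
def act (k : Option Gate) (l r : Bool) : Bool × Bool := k.elim (l, r) fun g => g.apply l r

/-- This is why windows that the signal never visits hold correct values as well. -/
theorem act_false (k : Option Gate) : act k false false = (false, false) := by
  rcases k with _ | (_ | _ | _ | _) <;> rfl

/-- The flags of layer `s`: they mark the windows up to which the signal travelled. -/
def flags (M L R s m : ℤ) : Bool := decide (M ∣ m ∧ M * (L - s) < m ∧ m ≤ M * R)

/-- The rows of bits computed by the diagram given by `K`; the signal can turn in windows whose
number is divisible by `M`, and turns at the right end in the window `M * R`. -/
structure Computes (K : ℤ → ℤ → Option Gate) (M L R : ℤ) (row : ℕ → ℤ → Bool) : Prop where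
  pos : 0 < M
  lt : L < R
  turn_iff : ∀ s m, K s m = none ↔ M ∣ m
  act : ∀ (s : ℕ) (m : ℤ), act (K s m) (row s (2 * m + s)) (row s (2 * m + s + 1)) =
    (row (s + 1) (2 * m + s), row (s + 1) (2 * m + s + 1))
  bounds : ∀ e, row 0 e = true → 2 * (M * L) < e ∧ e ≤ 2 * (M * R)

variable {K : ℤ → ℤ → Option Gate} {M L R : ℤ} {row : ℕ → ℤ → Bool}

/-- A new 1 needs an old 1 among the two columns of the same window, so the support grows by at most
one column on each side per layer. -/
theorem Computes.bounds' (h : Computes K M L R row) (s : ℕ) {e : ℤ} (he : row s e = true) :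
    2 * (M * L) - s < e ∧ e ≤ 2 * (M * R) + s := by
  induction s generalizing e with
  | zero => simpa using h.bounds e he
  | succ s ih =>
    by_contra hcon
    have h0 : ∀ e', e' ≤ 2 * (M * L) - s ∨ 2 * (M * R) + s < e' → row s e' = false := by
      intro e' h'
      by_contra h''
      have := ih (Bool.not_eq_false _ ▸ h'')
      omega
    push_cast at hcon
    have key := h.act s ((e - s) / 2)
    rw [h0 _ (by omega), h0 _ (by omega), act_false, Prod.mk.injEq] at key
    obtain h1 | h1 : 2 * ((e - s) / 2) + s = e ∨ 2 * ((e - s) / 2) + s + 1 = e := by omega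
    · rw [← h1, ← key.1] at he; cases he
    · rw [← h1, ← key.2] at he; cases he

/-- From layer to layer the western turn moves by `2 * M` columns west, less one for the shift of
layers; as `M ≥ 1` it keeps ahead of the support. -/
theorem Computes.left (h : Computes K M L R row) (s : ℕ) {e : ℤ}
    (he : e ≤ 2 * (M * (L - s)) + s) : row s e = false := by
  by_contra h'
  have := (h.bounds' s (Bool.not_eq_false _ ▸ h')).1
  have h2 : (s : ℤ) ≤ M * s := le_mul_of_one_le_left (by omega) h.pos
  rw [mul_sub] at he
  omega

/-- The window number `M * R` is fixed, but the shift of layers moves this window east as fast as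
the support can grow. -/
theorem Computes.right (h : Computes K M L R row) (s : ℕ) {e : ℤ}
    (he : 2 * (M * R) + s < e) : row s e = false := by
  by_contra h'
  have := (h.bounds' s (Bool.not_eq_false _ ▸ h')).2
  omega

theorem Computes.act_turn (h : Computes K M L R row) (s : ℕ) {m : ℤ} (hm : M ∣ m) :
    row (s + 1) (2 * m + s) = row s (2 * m + s) ∧
      row (s + 1) (2 * m + s + 1) = row s (2 * m + s + 1) := by
  have := h.act s m
  rw [(h.turn_iff s m).2 hm, WiresBoxes.act, Option.elim_none, Prod.mk.injEq] at this
  exact ⟨this.1.symm, this.2.symm⟩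

theorem Computes.layerWorks (h : Computes K M L R row) (s : ℕ) :
    LayerWorks s (M * (L - s)) (M * R) (fun m => tableOf (K s m)) (row s) (row (s + 1))
      (flags M L R s) (flags M L R (s + 1)) := by
  have hM := h.pos
  have hlt : M * (L - s) < M * R := mul_lt_mul_of_pos_left (by have := h.lt; omega) hM
  have hlt' : M * (L - (s + 1)) < M * (L - s) := mul_lt_mul_of_pos_left (by omega) hM
  have hflag : ∀ m, M ∣ m → M * (L - s) < m → m ≤ M * R →
      flags M L R s m = true ∧ flags M L R (s + 1) m = true := by
    intro m h1 h2 h3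
    simp only [flags, decide_eq_true_eq]
    exact ⟨⟨h1, h2, h3⟩, h1, by omega, h3⟩
  refine ⟨hlt, ?_, ?_, ?_, ?_, ?_, ?_, ?_⟩
  · obtain ⟨h1, h2⟩ := h.act_turn s (Int.dvd_mul_right M R)
    have h3 := h.right s (e := 2 * (M * R) + s + 1) (by omega)
    obtain ⟨h4, h5⟩ := hflag _ (Int.dvd_mul_right M R) hlt le_rfl
    simp only [initialOn, h1, h2, h3, h4, h5, (h.turn_iff s _).2 (Int.dvd_mul_right M R)]
    exact passable_start _
  · intro m h1 h2
    by_cases hd : M ∣ m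
    · obtain ⟨h3, h4⟩ := h.act_turn s hd
      obtain ⟨h5, h6⟩ := hflag m hd h1 h2.le
      simp only [initialOn, h3, h4, h5, h6, (h.turn_iff s _).2 hd]
      exact passable_turn _ _
    · have hf : ∀ s', flags M L R s' m = false := by
        intro s'
        simp [flags, hd]
      have key := h.act s m
      cases hK : K s m with
      | none => exact absurd ((h.turn_iff s m).1 hK) hd
      | some g =>
        rw [hK, WiresBoxes.act, Option.elim_some, Prod.ext_iff] at key
        simp only at key
        simp only [initialOn, hf, tableOf]
        rw [← key.1, ← key.2]
        exact passable_gate g _ _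
  · have hd := Int.dvd_mul_right M (L - s)
    obtain ⟨h1, h2⟩ := h.act_turn s hd
    have h3 := h.left s (e := 2 * (M * (L - s)) + s) le_rfl
    have h4 : flags M L R s (M * (L - s)) = false := by simp [flags]
    -- The strict inequality in `flags` makes the flag 0 exactly where layer `s` has to turn, and 1
    -- at the same window one layer later.
    have h5 : flags M L R (s + 1) (M * (L - s)) = true := by
      simp only [flags, decide_eq_true_eq]
      exact ⟨hd, hlt', hlt.le⟩
    simp only [initialOn, h1, h2, h3, h4, h5, (h.turn_iff s _).2 hd]
    exact leavesBy_turn _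
  · intro e he
    by_contra h'
    have := (h.bounds' (s + 1) (Bool.not_eq_false _ ▸ h')).1
    have h2 : (s : ℤ) ≤ M * s := le_mul_of_one_le_left (by omega) h.pos
    rw [mul_sub] at he
    push_cast at this
    omega
  · intro e he
    exact h.right (s + 1) (by push_cast; omega)
  · intro m hm
    simp only [flags, decide_eq_false_iff_not, not_and]
    intro ⟨k, hk⟩ h1
    subst hk
    have h2 := lt_of_mul_lt_mul_left hm hM.le
    have h3 := lt_of_mul_lt_mul_left h1 hM.le
    omega
  · intro m hm
    simp only [flags, decide_eq_false_iff_not, not_and]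
    intro _ _
    omega

/-- The diagram computes all rows, one after the other. -/
theorem Computes.exists_run (h : Computes K M L R row) :
    ∃ (ρ : ℕ → Config) (τ : ℕ → ℕ),
      ρ 0 = (diagram K (initialStates (row 0) (flags M L R 0))).init
        (place (corner 0 (M * R)) 11 1, .south) ∧
      (∀ n, Step (diagram K (initialStates (row 0) (flags M L R 0))) (ρ n) (ρ (n + 1))) ∧
      τ 0 = 0 ∧ StrictMono τ ∧
      ∀ s n e, τ s ≤ n → (ρ n).state (dataCell s e) = row s e := by
  set D := diagram K (initialStates (row 0) (flags M L R 0)) with hD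
  have hnext : ∀ (s : ℕ) (c : Config), AtLayer s (M * R) (row s) (flags M L R s) c →
      ∃ c', Goes D s c c' ∧
        AtLayer (s + 1 : ℕ) (M * R) (row (s + 1)) (flags M L R (s + 1 : ℕ)) c' := by
    intro s c hc
    push_cast
    exact (h.layerWorks s).run (fun m => diagram_shows K _ s m) hc
  choose! g hg hg' using hnext
  let C : ℕ → Config := fun n => Nat.rec (D.init (place (corner 0 (M * R)) 11 1, .south)) g n
  have hC : ∀ n : ℕ, AtLayer n (M * R) (row n) (flags M L R n) (C n) := by
    intro n
    induction n with
    | zero => exact atLayer_init K (row 0) (flags M L R 0) (M * R)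
    | succ n ih => exact hg' n _ ih
  have hgo : ∀ n : ℕ, Goes D n (C n) (C (n + 1)) := fun n => hg n _ (hC n)
  have hdata : ∀ (s k : ℕ) (e : ℤ), (C (s + k)).state (dataCell s e) = row s e := by
    intro s k e
    induction k with
    | zero =>
      rw [Bool.eq_iff_iff, add_zero, (hC s).state _ (by simp [dataCell])]
      constructor
      · rintro (⟨e', h1, h2⟩ | ⟨m, h1, -⟩)
        · simp only [dataCell, Prod.mk.injEq] at h1
          rwa [show e = e' by omega]
        · exact absurd h1 (dataCell_ne_flagCell _ _ _ _)
      · exact fun h1 => Or.inl ⟨e, rfl, h1⟩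
    | succ k ih => rw [← ih]; exact (hgo (s + k)).2 s e (by push_cast; omega)
  obtain ⟨ρ, τ, h1, h2, h3, h4⟩ := exists_infinite_run fun n => (hgo n).1
  refine ⟨ρ, τ, (congrArg ρ h2.symm).trans (h4 0), h1, h2, h3, fun s n e hn => ?_⟩
  have hmono : ∀ (a b : ℕ), a ≤ b → ∀ z, (ρ a).state z = true → (ρ b).state z = true := by
    intro a b hab z hz
    induction b, hab using Nat.le_induction with
    | base => exact hz
    | succ b _ ih => exact (h1 b).mono ih
  cases hr : row s e with
  | true =>
    refine hmono _ _ hn _ ?_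
    rw [h4, ← hr]
    exact hdata s 0 e
  | false =>
    by_contra hne
    -- The bit is known to be 0 again at the start of the later layer `s + n`; by monotonicity it
    -- cannot be 1 in between.
    have h5 : n ≤ τ (s + n) := (Nat.le_add_left n s).trans h3.le_apply
    have := hmono _ _ h5 _ (Bool.not_eq_false _ ▸ hne)
    rw [h4, hdata, hr] at this
    cases this

/-! ## Programs -/

section Ops

variable {W : ℕ}

/-- Apply `g` to the columns congruent to `p` and `p + 1`. -/
def pairRow (W : ℕ) (p : ℤ) (g : Bool → Bool → Bool × Bool) (row : ℤ → Bool) (c : ℤ) : Bool :=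
  if (c : ZMod W) = p then (g (row c) (row (c + 1))).1
  else if (c : ZMod W) = p + 1 then (g (row (c - 1)) (row c)).2 else row c

theorem pairRow_pairRow [Fact (1 < W)] (p : ℤ) (g h : Bool → Bool → Bool × Bool)
    (row : ℤ → Bool) :
    pairRow W p g (pairRow W p h row) = pairRow W p (fun l r => g (h l r).1 (h l r).2) row := by
  funext c
  by_cases h1 : (c : ZMod W) = p
  · simp [pairRow, h1]
  · by_cases h2 : (c : ZMod W) = p + 1
    · simp [pairRow, h2]
    · simp [pairRow, h1, h2]

/-- A program: in every step one gate is applied to two columns of each block. -/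
def runOps (W : ℕ) (L : List (ℤ × Gate)) (row : ℤ → Bool) : ℤ → Bool :=
  L.foldl (fun r o => pairRow W o.1 o.2.apply r) row

theorem runOps_append (L L' : List (ℤ × Gate)) (row : ℤ → Bool) :
    runOps W (L ++ L') row = runOps W L' (runOps W L row) :=
  List.foldl_append

/-- Some program has the effect `F`. -/
def Programmable (W : ℕ) (F : (ℤ → Bool) → ℤ → Bool) : Prop :=
  ∃ L, ∀ row, runOps W L row = F row

theorem Programmable.comp {F G : (ℤ → Bool) → ℤ → Bool} (hF : Programmable W F)
    (hG : Programmable W G) : Programmable W fun row => F (G row) := by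
  obtain ⟨L, hL⟩ := hF
  obtain ⟨L', hL'⟩ := hG
  exact ⟨L' ++ L, fun row => by rw [runOps_append, hL', hL]⟩

theorem programmable_gate (p : ℤ) (g : Gate) : Programmable W (pairRow W p g.apply) :=
  ⟨[(p, g)], fun _ => rfl⟩

/-- The permutation of columns that exchanges those congruent to `p` and `p + 1`. -/
def exchange (W : ℕ) (p c : ℤ) : ℤ :=
  if (c : ZMod W) = p then c + 1 else if (c : ZMod W) = p + 1 then c - 1 else c

theorem exchange_exchange [Fact (1 < W)] (p c : ℤ) : exchange W p (exchange W p c) = c := by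
  by_cases h1 : (c : ZMod W) = p
  · simp [exchange, h1]
  · by_cases h2 : (c : ZMod W) = p + 1
    · simp [exchange, h2]
    · simp [exchange, h1, h2]

theorem exchange_add (p c k : ℤ) : exchange W p (c + W * k) = exchange W p c + W * k := by
  simp only [exchange, Int.cast_add, Int.cast_mul, Int.cast_natCast, ZMod.natCast_self, zero_mul,
    add_zero]
  split_ifs <;> ring

/-- The exchange of two bits by three additions modulo 2. -/
theorem programmable_exchange [Fact (1 < W)] (p : ℤ) :
    Programmable W fun row c => row (exchange W p c) := by
  obtain ⟨L, hL⟩ := ((programmable_gate (W := W) p .addRight).comp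
    (programmable_gate p .addLeft)).comp (programmable_gate p .addRight)
  refine ⟨L, fun row => ?_⟩
  rw [hL]
  beta_reduce
  rw [pairRow_pairRow, pairRow_pairRow]
  funext c
  have key : ∀ l r : Bool, Gate.addRight.apply
      (Gate.addLeft.apply (Gate.addRight.apply l r).1 (Gate.addRight.apply l r).2).1
      (Gate.addLeft.apply (Gate.addRight.apply l r).1 (Gate.addRight.apply l r).2).2 = (r, l) := by
    decide
  simp only [pairRow, exchange, key]
  split_ifs <;> rfl

/-! ### Controlled operations on distant columns -/

theorem intCast_eq_iff {c d : ℤ} : (c : ZMod W) = d ↔ ∃ k, c = d + W * k := by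
  rw [eq_comm, ZMod.intCast_eq_intCast_iff_dvd_sub]
  exact ⟨fun ⟨k, hk⟩ => ⟨k, by omega⟩, fun ⟨k, hk⟩ => ⟨k, by omega⟩⟩

theorem intCast_ne {c d : ℤ} (h1 : c ≠ d) (h2 : |c - d| < W) : (c : ZMod W) ≠ d := by
  rw [Ne, eq_comm, ZMod.intCast_eq_intCast_iff_dvd_sub]
  intro h
  exact h1 (sub_eq_zero.1 (Int.eq_zero_of_abs_lt_dvd h h2))

/-- Columns congruent to `d` are changed by `φ`, with the column at distance `s - d` as first
argument. -/
def control (W : ℕ) (φ : Bool → Bool → Bool) (s d : ℤ) (row : ℤ → Bool) (c : ℤ) : Bool :=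
  if (c : ZMod W) = d then φ (row (c - d + s)) (row c) else row c

/-- The exchange is an involution commuting with translation by `W`, so conjugation by it relabels
the source and the target in all blocks at once. -/
theorem control_conj [Fact (1 < W)] (φ : Bool → Bool → Bool) (p s d : ℤ) (row : ℤ → Bool) :
    (fun c => control W φ (exchange W p s) (exchange W p d) (fun c => row (exchange W p c))
      (exchange W p c)) = control W φ s d row := by
  funext c
  by_cases h : (c : ZMod W) = d
  · obtain ⟨k, rfl⟩ := intCast_eq_iff.1 h
    have h' := intCast_eq_iff.2 ⟨k, exchange_add (W := W) p d k⟩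
    rw [control, control, if_pos h, if_pos h', exchange_exchange, exchange_add,
      show exchange W p d + W * k - exchange W p d + exchange W p s =
        exchange W p s + W * k by ring, exchange_add, exchange_exchange,
      show d + W * k - d + s = s + W * k by ring]
  · have h' : (exchange W p c : ZMod W) ≠ exchange W p d := by
      intro h'
      obtain ⟨k, hk⟩ := intCast_eq_iff.1 h'
      refine h (intCast_eq_iff.2 ⟨k, ?_⟩)
      rw [← exchange_exchange (W := W) p c, hk, exchange_add, exchange_exchange]
    rw [control, control, if_neg h, if_neg h', exchange_exchange]

theorem Programmable.conj [Fact (1 < W)] {φ : Bool → Bool → Bool} (p : ℤ) {s d s' d' : ℤ}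
    (h : Programmable W (control W φ s' d')) (hs : exchange W p s = s')
    (hd : exchange W p d = d') : Programmable W (control W φ s d) := by
  obtain ⟨L, hL⟩ := ((programmable_exchange p).comp h).comp (programmable_exchange p)
  refine ⟨L, fun row => ?_⟩
  rw [hL, ← control_conj (W := W) φ p, hs, hd]

theorem exchange_left (p : ℤ) : exchange W p p = p + 1 := if_pos rfl

theorem exchange_right [Fact (1 < W)] (p : ℤ) : exchange W p (p + 1) = p := by
  rw [← exchange_left (W := W), exchange_exchange]

theorem exchange_of_ne {p c : ℤ} (h1 : (c : ZMod W) ≠ p) (h2 : (c : ZMod W) ≠ (p + 1 : ℤ)) :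
    exchange W p c = c := by
  rw [Int.cast_add, Int.cast_one] at h2
  rw [exchange, if_neg h1, if_neg h2]

theorem pairRow_eq_control [Fact (1 < W)] {g : Gate} {φ : Bool → Bool → Bool}
    (h : ∀ l r, g.apply l r = (l, φ l r)) (p : ℤ) :
    pairRow W p g.apply = control W φ p (p + 1) := by
  funext row c
  by_cases h1 : (c : ZMod W) = p
  · simp [pairRow, control, h, h1]
  · simp only [pairRow, control, h, if_neg h1, Int.cast_add, Int.cast_one]
    rw [show c - (p + 1) + p = c - 1 by ring]

theorem programmable_control [Fact (1 < W)] {φ : Bool → Bool → Bool}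
    (hφ : ∃ g : Gate, ∀ l r, g.apply l r = (l, φ l r)) {s d : ℤ} (hne : s ≠ d)
    (hlt : |s - d| < W) : Programmable W (control W φ s d) := by
  have right : ∀ (n : ℕ) (s : ℤ), n + 1 < W → Programmable W (control W φ s (s + n + 1)) := by
    intro n
    induction n with
    | zero =>
      intro s _
      obtain ⟨g, hg⟩ := hφ
      simpa [pairRow_eq_control hg] using programmable_gate (W := W) s g
    | succ n ih =>
      intro s hn
      -- The exchange brings the source one column closer. It leaves the target alone, which is
      -- congruent neither to `s` nor to `s + 1` because the distance is below `W`.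
      refine (ih (s + 1) (by omega)).conj s (exchange_left s) ?_
      push_cast
      rw [exchange_of_ne]
      · ring
      · refine intCast_ne (by omega) ?_
        rw [abs_of_nonneg] <;> omega
      · refine intCast_ne (by omega) ?_
        rw [abs_of_nonneg] <;> omega
  have left : ∀ (n : ℕ) (d : ℤ), n + 1 < W → Programmable W (control W φ (d + n + 1) d) := by
    intro n
    induction n with
    | zero =>
      intro d hn
      -- For neighbouring columns, exchanging the two reverses the direction of control.
      refine (right 0 d hn).conj d ?_ ?_
      · simpa using exchange_right d
      · simpa using exchange_left d
    | succ n ih =>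
      intro d hn
      refine (ih (d + 1) (by omega)).conj d ?_ (exchange_left d)
      push_cast
      rw [exchange_of_ne]
      · ring
      · refine intCast_ne (by omega) ?_
        rw [abs_of_nonneg] <;> omega
      · refine intCast_ne (by omega) ?_
        rw [abs_of_nonneg] <;> omega
  rw [abs_lt] at hlt
  rcases hne.lt_or_gt with h | h
  · have := right (d - s - 1).toNat s (by omega)
    rwa [show s + (d - s - 1).toNat + 1 = d by omega] at this
  · have := left (s - d - 1).toNat d (by omega)
    rwa [show d + (s - d - 1).toNat + 1 = s by omega] at this

end Ops

/-! ## Programs executed by diagrams -/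

section Execution

/-- The operation of a cyclically repeated program in step `j`. -/
def opAt (L : List (ℤ × Gate)) (j : ℤ) : ℤ × Gate := L.getD (j % L.length).toNat (0, .id)

/-- The windows of the diagram that executes a program; each operation takes `2 * M` layers. -/
def windows (M : ℕ) (L : List (ℤ × Gate)) (s m : ℤ) : Option Gate :=
  if (M : ℤ) ∣ m then none
  else some (if (M : ℤ) ∣ m + 1 ∧ (2 * M : ℤ) ∣ s - (opAt L (s / (2 * M))).1 - 2
    then (opAt L (s / (2 * M))).2 else .id)

/-- The rows of bits computed by a program. -/
def rows (M : ℕ) (L : List (ℤ × Gate)) (X : ℤ → Bool) : ℕ → ℤ → Bool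
  | 0 => X
  | s + 1 =>
    if (2 * M : ℤ) ∣ s - (opAt L (s / (2 * M))).1 - 2 then
      pairRow (2 * M) (opAt L (s / (2 * M))).1 (opAt L (s / (2 * M))).2.apply (rows M L X s)
    else rows M L X s

variable {M : ℕ} {L : List (ℤ × Gate)}

theorem opAt_add (L : List (ℤ × Gate)) (j k : ℤ) : opAt L (j + L.length * k) = opAt L j := by
  simp [opAt]

theorem windows_add_left (L : List (ℤ × Gate)) (s m : ℤ) :
    windows M L s (m + M) = windows M L s m := by
  simp only [windows, add_right_comm m (M : ℤ) 1, dvd_add_self_right]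

/-- Descending `2 * M * L.length` layers drifts east by as many columns; subtracting `M * L.length`
from the window number compensates this, so the period is vertical. -/
theorem windows_add (hM : 0 < M) (L : List (ℤ × Gate)) (s m : ℤ) :
    windows M L (s + 2 * M * L.length) (m + -(M * L.length)) = windows M L s m := by
  have h1 : (s + 2 * M * L.length) / (2 * M) = s / (2 * M) + L.length * 1 := by
    rw [Int.add_mul_ediv_left _ _ (by positivity), mul_one]
  have h2 : ∀ k : ℤ, (M : ℤ) ∣ k + -(M * L.length) ↔ (M : ℤ) ∣ k := fun k =>
    Int.dvd_add_left (Int.dvd_neg.2 (Int.dvd_mul_right _ _))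
  have h3 : ∀ k : ℤ, (2 * M : ℤ) ∣ s + 2 * M * L.length - k - 2 ↔ (2 * M : ℤ) ∣ s - k - 2 := by
    intro k
    rw [show s + 2 * M * L.length - k - 2 = s - k - 2 + 2 * M * L.length by ring]
    exact Int.dvd_add_left (Int.dvd_mul_right _ _)
  simp only [windows, h1, h2, h3, opAt_add, add_right_comm m _ 1]

theorem even_of_dvd {k : ℤ} (h : (2 * M : ℤ) ∣ k) : (2 : ℤ) ∣ k := (Int.dvd_mul_right _ _).trans h

/-- A gate for columns `p`, `p + 1` is put into windows with `m ≡ -1` modulo `M`, in the layer where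
these have drifted onto column `p`: modulo `2 * M`, `2 * m + s ≡ p` means `s ≡ p + 2`. -/
theorem computes_windows (hM : 2 ≤ M) (L : List (ℤ × Gate)) (X : ℤ → Bool) {lo hi : ℤ}
    (hlt : lo < hi) (hX : ∀ e, X e = true → 2 * (M * lo) < e ∧ e ≤ 2 * (M * hi)) :
    Computes (windows M L) M lo hi (rows M L X) := by
  refine ⟨by omega, hlt, fun s m => ?_, fun s m => ?_, hX⟩
  · by_cases h : (M : ℤ) ∣ m <;> simp [windows, h]
  · generalize ho : opAt L (s / (2 * M)) = o
    obtain ⟨p, g⟩ := o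
    have hcast : ∀ c d : ℤ, (c : ZMod (2 * M)) = d ↔ (2 * M : ℤ) ∣ c - d := by
      intro c d
      rw [eq_comm, ZMod.intCast_eq_intCast_iff_dvd_sub]
      push_cast
      rfl
    by_cases hs : (2 * M : ℤ) ∣ s - p - 2
    · have e1 : (2 * M : ℤ) ∣ 2 * m + s - p ↔ (M : ℤ) ∣ m + 1 := by
        rw [show 2 * m + s - p = 2 * (m + 1) + (s - p - 2) by ring, Int.dvd_add_left hs,
          mul_dvd_mul_iff_left two_ne_zero]
      have hev := even_of_dvd hs
      -- In this layer the left column of every window has the parity of `p`, so no pair is met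
      -- across two windows.
      have e2 : ¬ (2 * M : ℤ) ∣ 2 * m + s - (p + 1) := fun h => by
        have := even_of_dvd h; omega
      have e3 : ¬ (2 * M : ℤ) ∣ 2 * m + s + 1 - p := fun h => by
        have := even_of_dvd h; omega
      have hp : (p : ZMod (2 * M)) + 1 = ((p + 1 : ℤ) : ZMod (2 * M)) := by push_cast; rfl
      simp only [rows, ho, if_pos hs, pairRow, hp, hcast, e2, e3, if_false,
        add_sub_add_right_eq_sub, e1]
      by_cases h1 : (M : ℤ) ∣ m + 1
      -- Since `M ≥ 2`, a window with a gate is never one that is reserved for turning.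
      · have h0 : ¬ (M : ℤ) ∣ m := fun h0 => by
          have := (Int.dvd_add_right h0).1 h1
          have := Int.le_of_dvd one_pos this
          omega
        simp [windows, h0, h1, ho, hs, act]
      · by_cases h0 : (M : ℤ) ∣ m
        · simp [windows, h0, h1, act]
        · simp [windows, h0, h1, act, Gate.apply]
    · simp only [rows, ho, if_neg hs]
      by_cases h0 : (M : ℤ) ∣ m
      · simp [windows, h0, act]
      · simp [windows, h0, ho, hs, act, Gate.apply]

theorem rows_slot (hM : 0 < M) (L : List (ℤ × Gate)) (X : ℤ → Bool) (j : ℕ) :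
    rows M L X (2 * M * (j + 1)) =
      pairRow (2 * M) (opAt L j).1 (opAt L j).2.apply (rows M L X (2 * M * j)) := by
  -- The only one of the `2 * M` layers of a slot in which the operation takes place; in all others
  -- the bits are copied.
  set r : ℕ := (((opAt L j).1 + 2) % (2 * M : ℤ)).toNat with hr
  have hr0 := Int.emod_nonneg ((opAt L j).1 + 2) (b := (2 * M : ℤ)) (by positivity)
  have hr1 := Int.emod_lt_of_pos ((opAt L j).1 + 2) (b := (2 * M : ℤ)) (by positivity)
  have key : ∀ n : ℕ, n ≤ 2 * M → rows M L X (2 * M * j + n) =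
      if r < n then pairRow (2 * M) (opAt L j).1 (opAt L j).2.apply (rows M L X (2 * M * j))
      else rows M L X (2 * M * j) := by
    intro n
    induction n with
    | zero => simp
    | succ n ih =>
      intro hn
      have ih := ih (by omega)
      have hdiv : ((2 * M * j + n : ℕ) : ℤ) / (2 * M) = j := by
        push_cast
        rw [add_comm, Int.add_mul_ediv_left _ _ (by positivity), Int.ediv_eq_zero_of_lt] <;> omega
      have hmod : (2 * M : ℤ) ∣ ((2 * M * j + n : ℕ) : ℤ) - (opAt L j).1 - 2 ↔ n = r := by
        have hq := Int.mul_ediv_add_emod ((opAt L j).1 + 2) (2 * M)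
        rw [show ((2 * M * j + n : ℕ) : ℤ) - (opAt L j).1 - 2 =
          (n - r) + 2 * M * (j - ((opAt L j).1 + 2) / (2 * M)) by
            rw [hr, Int.toNat_of_nonneg hr0]; push_cast; linarith,
          Int.dvd_add_left (Int.dvd_mul_right _ _)]
        refine ⟨fun h => ?_, fun h => by simp [h]⟩
        have := Int.eq_zero_of_abs_lt_dvd h (by rw [abs_lt]; omega)
        omega
      rw [← add_assoc, rows, hdiv]
      by_cases h : n = r
      · rw [if_pos (hmod.2 h), ih, if_neg (by omega), if_pos (by omega)]
      · rw [if_neg (hmod.not.2 h), ih]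
        exact if_congr (by omega) rfl rfl
  have := key (2 * M) le_rfl
  rwa [if_pos (by omega), ← mul_add_one] at this

theorem rows_cycle (hM : 0 < M) (L : List (ℤ × Gate)) (X : ℤ → Bool) (t : ℕ) :
    rows M L X (2 * M * L.length * (t + 1)) =
      runOps (2 * M) L (rows M L X (2 * M * L.length * t)) := by
  have key : ∀ j : ℕ, j ≤ L.length → rows M L X (2 * M * (L.length * t + j)) =
      runOps (2 * M) (L.take j) (rows M L X (2 * M * L.length * t)) := by
    intro j
    induction j with
    | zero => intro _; simp [runOps, mul_assoc]
    | succ j ih =>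
      intro hj
      have ho : opAt L ((L.length * t + j : ℕ) : ℤ) = L[j] := by
        push_cast
        rw [add_comm, opAt_add, opAt, Int.emod_eq_of_lt (by omega) (by omega), Int.toNat_natCast,
          List.getD_eq_getElem _ _ hj]
      rw [← add_assoc, rows_slot hM, ih (by omega), ho, List.take_add_one,
        List.getElem?_eq_getElem hj, runOps_append]
      rfl
  have := key _ le_rfl
  rwa [List.take_length, ← mul_add_one, ← mul_assoc] at this

end Execution

/-! ## A program for a cellular automaton -/

/-- The registers of a block: the bits of the state of the previous cell, of the own state and of
the new state, an auxiliary bit and a bit that is always 0. -/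
inductive Reg (N : ℕ) where
  | prev (k : Fin N)
  | cur (k : Fin N)
  | new (k : Fin N)
  | tmp
  | zero
  deriving DecidableEq

/-- Half of the number of columns of a block. -/
def halfWidth (N : ℕ) : ℕ := 2 * N + 2

/-- Number of columns of a block. -/
def width (N : ℕ) : ℕ := 2 * halfWidth N

/-- The column of a register. -/
def Reg.pos {N : ℕ} : Reg N → ℤ
  | .prev k => k
  | .cur k => N + k
  | .new k => 2 * N + k
  | .tmp => 3 * N
  | .zero => 3 * N + 1

section Registers

variable {N : ℕ}

instance : Fact (1 < width N) := ⟨by simp only [width, halfWidth]; omega⟩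

theorem Reg.pos_nonneg (r : Reg N) : 0 ≤ r.pos := by cases r <;> simp only [Reg.pos] <;> omega

theorem Reg.pos_lt (r : Reg N) : r.pos < width N := by
  cases r <;> simp only [Reg.pos, width, halfWidth] <;> push_cast <;> omega

theorem Reg.pos_injective : Function.Injective (Reg.pos (N := N)) := by
  intro r r' h
  cases r <;> cases r' <;> simp only [Reg.pos] at h <;>
    simp only [Reg.prev.injEq, Reg.cur.injEq, Reg.new.injEq, reduceCtorEq, Fin.ext_iff] <;> omega

open Classical in
/-- The row of bits with the given contents of the registers of all blocks. -/
noncomputable def pack (S : ℤ → Reg N → Bool) (c : ℤ) : Bool :=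
  if h : ∃ r : Reg N, r.pos = c % width N then S (c / width N) h.choose else false

theorem column_emod (i : ℤ) (r : Reg N) : (width N * i + r.pos) % width N = r.pos := by
  rw [add_comm, Int.add_mul_emod_self_left, Int.emod_eq_of_lt r.pos_nonneg r.pos_lt]

theorem column_ediv (i : ℤ) (r : Reg N) : (width N * i + r.pos) / width N = i := by
  rw [add_comm, Int.add_mul_ediv_left _ _ (by simp only [width, halfWidth]; push_cast; omega),
    Int.ediv_eq_zero_of_lt r.pos_nonneg r.pos_lt, zero_add]

theorem column_inj {i i' : ℤ} {r r' : Reg N}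
    (h : width N * i + r.pos = width N * i' + r'.pos) : i = i' ∧ r = r' :=
  ⟨by rw [← column_ediv i r, h, column_ediv],
    Reg.pos_injective (by rw [← column_emod i r, h, column_emod])⟩

theorem pack_column (S : ℤ → Reg N → Bool) (i : ℤ) (r : Reg N) :
    pack S (width N * i + r.pos) = S i r := by
  have h : ∃ r' : Reg N, r'.pos = (width N * i + r.pos) % width N := ⟨r, (column_emod i r).symm⟩
  rw [pack, dif_pos h, column_ediv, Reg.pos_injective (h.choose_spec.trans (column_emod i r))]

theorem column_or (c : ℤ) :
    (∃ (i : ℤ) (r : Reg N), c = width N * i + r.pos) ∨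
      (∀ r : Reg N, r.pos ≠ c % width N) ∧ ∀ S : ℤ → Reg N → Bool, pack S c = false := by
  by_cases h : ∃ r : Reg N, r.pos = c % width N
  · obtain ⟨r, hr⟩ := h
    exact Or.inl ⟨c / width N, r, by rw [hr, Int.mul_ediv_add_emod]⟩
  · exact Or.inr ⟨not_exists.1 h, fun S => dif_neg h⟩

/-- Controlled operations become simultaneous register instructions; `δ` tells how many blocks to
the left the source is. -/
theorem control_pack (φ : Bool → Bool → Bool) (δ : ℤ) (r r' : Reg N) (S : ℤ → Reg N → Bool) :
    control (width N) φ (r.pos - width N * δ) r'.pos (pack S) =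
      pack fun i => Function.update (S i) r' (φ (S (i - δ) r) (S i r')) := by
  funext c
  obtain ⟨i, r₀, rfl⟩ | ⟨h1, h2⟩ := column_or (N := N) c
  · rw [pack_column]
    by_cases h : r₀ = r'
    · subst h
      rw [control, if_pos (intCast_eq_iff.2 ⟨i, add_comm _ _⟩), Function.update_self, pack_column,
        show width N * i + r₀.pos - r₀.pos + (r.pos - width N * δ) =
          width N * (i - δ) + r.pos by ring, pack_column]
    · rw [control, if_neg, Function.update_of_ne h, pack_column]
      intro h'
      obtain ⟨k, hk⟩ := intCast_eq_iff.1 h'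
      rw [add_comm r'.pos] at hk
      exact h (column_inj hk).2
  · rw [h2, control, if_neg, h2]
    intro h'
    obtain ⟨k, rfl⟩ := intCast_eq_iff.1 h'
    exact h1 r' (by rw [add_comm, column_emod])

theorem exists_instruction {φ : Bool → Bool → Bool}
    (hφ : ∃ g : Gate, ∀ l r, g.apply l r = (l, φ l r)) {r r' : Reg N} (h : r ≠ r') :
    ∃ L, ∀ S, runOps (width N) L (pack S) =
      pack fun i => Function.update (S i) r' (φ (S i r) (S i r')) := by
  have h1 := r.pos_nonneg
  have h2 := r.pos_lt
  have h3 := r'.pos_nonneg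
  have h4 := r'.pos_lt
  obtain ⟨L, hL⟩ := programmable_control (W := width N) hφ (Reg.pos_injective.ne h)
    (by rw [abs_lt]; omega)
  refine ⟨L, fun S => ?_⟩
  have := control_pack φ 0 r r' S
  simp only [mul_zero, sub_zero] at this
  rw [hL, this]

theorem xor_isGate : ∃ g : Gate, ∀ l r, g.apply l r = (l, xor l r) := ⟨.addRight, fun _ _ => rfl⟩

theorem and_isGate : ∃ g : Gate, ∀ l r, g.apply l r = (l, l && r) := ⟨.and, fun _ _ => rfl⟩

theorem exists_fetch (k : Fin N) :
    ∃ L, ∀ S : ℤ → Reg N → Bool, runOps (width N) L (pack S) =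
      pack fun i => Function.update (S i) (.prev k) (xor (S (i - 1) (.cur k)) (S i (.prev k))) := by
  obtain ⟨L, hL⟩ := programmable_control (W := width N) xor_isGate
    -- The source lies in the previous block, at distance `width N - N`, still less than a block.
    (s := (Reg.cur k).pos - width N * 1) (d := (Reg.prev k).pos)
    (by simp only [Reg.pos, width, halfWidth]; push_cast; omega)
    (by rw [abs_lt]; simp only [Reg.pos, width, halfWidth]; push_cast; omega)
  exact ⟨L, fun S => by rw [hL, control_pack]⟩

/-- The contents of all registers; the last one is 0. -/
def contents (p x y : ℤ → Fin N → Bool) (t : ℤ → Bool) (i : ℤ) : Reg N → Bool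
  | .prev k => p i k
  | .cur k => x i k
  | .new k => y i k
  | .tmp => t i
  | .zero => false

/-- The registers `prev` start at 0, so adding to them is copying. -/
theorem exists_fetch_all (s : Finset (Fin N)) :
    ∃ L, ∀ x : ℤ → Fin N → Bool,
      runOps (width N) L (pack (contents (fun _ _ => false) x (fun _ _ => false) fun _ => false)) =
        pack (contents (fun i k => decide (k ∈ s) && x (i - 1) k) x (fun _ _ => false)
          fun _ => false) := by
  induction s using Finset.induction_on with
  | empty => exact ⟨[], fun x => by simp [runOps]⟩
  | insert j s hj ih =>
    obtain ⟨L, hL⟩ := ih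
    obtain ⟨L', hL'⟩ := exists_fetch j
    refine ⟨L ++ L', fun x => ?_⟩
    rw [runOps_append, hL, hL']
    congr 1
    funext i r
    cases r with
    | prev k =>
      by_cases h : k = j
      · subst h; simp [contents, hj]
      · simp [contents, h]
    | _ => simp [contents]

/-- Conjunction with the register `zero` clears a register, and addition to a cleared register
copies. This restores the form that the next cycle of the program expects. -/
theorem exists_finish (s : Finset (Fin N)) :
    ∃ L, ∀ p x y : ℤ → Fin N → Bool,
      runOps (width N) L (pack (contents p x y fun _ => false)) =
        pack (contents (fun i k => !decide (k ∈ s) && p i k)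
          (fun i k => if k ∈ s then y i k else x i k) (fun i k => !decide (k ∈ s) && y i k)
          fun _ => false) := by
  induction s using Finset.induction_on with
  | empty => exact ⟨[], fun p x y => by simp [runOps]⟩
  | insert j s hj ih =>
    obtain ⟨L, hL⟩ := ih
    obtain ⟨L₁, hL₁⟩ := exists_instruction and_isGate (r := .zero) (r' := .cur j) (by simp)
    obtain ⟨L₂, hL₂⟩ := exists_instruction xor_isGate (r := .new j) (r' := .cur j) (by simp)
    obtain ⟨L₃, hL₃⟩ := exists_instruction and_isGate (r := .zero) (r' := .new j) (by simp)
    obtain ⟨L₄, hL₄⟩ := exists_instruction and_isGate (r := .zero) (r' := .prev j) (by simp)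
    refine ⟨L ++ L₁ ++ L₂ ++ L₃ ++ L₄, fun p x y => ?_⟩
    simp only [runOps_append, hL, hL₁, hL₂, hL₃, hL₄]
    congr 1
    funext i r
    cases r with
    | prev k | cur k | new k =>
      by_cases h : k = j
      · subst h; simp [contents, hj]
      · simp [contents, h]
    | _ => simp [contents]

/-! ### The local function as a sum of products of bits -/

section Automaton

variable {A : Type*} {q : A} (e : Fin N ≃ {a : A // a ≠ q})

open Classical in
/-- The code of states: one bit for each non-quiescent state. -/
noncomputable def code (a : A) (k : Fin N) : Bool := decide (a = e k)

theorem code_injective : Function.Injective (code e) := by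
  intro a b h
  by_contra hne
  obtain ha | hb : a ≠ q ∨ b ≠ q := by
    by_contra! h'
    exact hne (h'.1.trans h'.2.symm)
  · have := congrFun h (e.symm ⟨a, ha⟩)
    simp [code] at this
    exact hne this.symm
  · have := congrFun h (e.symm ⟨b, hb⟩)
    simp [code] at this
    exact hne this

theorem code_quiescent : code e q = fun _ => false := by
  funext k
  simpa [code] using fun h => (e k).2 h.symm

theorem code_symm (a b : A) (hb : b ≠ q) [Decidable (a = b)] :
    code e a (e.symm ⟨b, hb⟩) = decide (a = b) := by
  simp [code]

/-- Some program adds the bits `G a b` to the new state, where `a` is the state of the previous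
cell and `b` is the own state. -/
def Adds (G : A → A → Fin N → Bool) : Prop :=
  ∃ L, ∀ (a b : ℤ → A) (y : ℤ → Fin N → Bool),
    runOps (width N) L
        (pack (contents (fun i => code e (a i)) (fun i => code e (b i)) y fun _ => false)) =
      pack (contents (fun i => code e (a i)) (fun i => code e (b i))
        (fun i k => xor (y i k) (G (a i) (b i) k)) fun _ => false)

variable {e}

theorem Adds.xor {G H : A → A → Fin N → Bool} (hG : Adds e G) (hH : Adds e H) :
    Adds e fun a b k => Bool.xor (G a b k) (H a b k) := by
  obtain ⟨L, hL⟩ := hG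
  obtain ⟨L', hL'⟩ := hH
  exact ⟨L ++ L', fun a b y => by simp only [runOps_append, hL, hL', Bool.xor_assoc]⟩

variable (e)

theorem adds_false : Adds e fun _ _ _ => false := ⟨[], fun a b y => by simp [runOps]⟩

theorem adds_prev (j c : Fin N) : Adds e fun a _ k => decide (k = c) && code e a j := by
  obtain ⟨L, hL⟩ := exists_instruction xor_isGate (r := .prev j) (r' := .new c) (by simp)
  refine ⟨L, fun a b y => ?_⟩
  rw [hL]
  congr 1
  funext i r
  cases r with
  | new k =>
    by_cases h : k = c
    · subst h; simp [contents, Bool.xor_comm]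
    · simp [contents, h]
  | _ => simp [contents]

theorem adds_cur (j c : Fin N) : Adds e fun _ b k => decide (k = c) && code e b j := by
  obtain ⟨L, hL⟩ := exists_instruction xor_isGate (r := .cur j) (r' := .new c) (by simp)
  refine ⟨L, fun a b y => ?_⟩
  rw [hL]
  congr 1
  funext i r
  cases r with
  | new k =>
    by_cases h : k = c
    · subst h; simp [contents, Bool.xor_comm]
    · simp [contents, h]
  | _ => simp [contents]

/-- The product is formed in `tmp`, added, and `tmp` is cleared for later use. -/
theorem adds_and (j l c : Fin N) :
    Adds e fun a b k => decide (k = c) && (code e a j && code e b l) := by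
  obtain ⟨L₁, hL₁⟩ := exists_instruction xor_isGate (r := .prev j) (r' := .tmp) (by simp)
  obtain ⟨L₂, hL₂⟩ := exists_instruction and_isGate (r := .cur l) (r' := .tmp) (by simp)
  obtain ⟨L₃, hL₃⟩ := exists_instruction xor_isGate (r := .tmp) (r' := .new c) (by simp)
  obtain ⟨L₄, hL₄⟩ := exists_instruction (N := N) and_isGate (r := .zero) (r' := .tmp) (by simp)
  refine ⟨L₁ ++ L₂ ++ L₃ ++ L₄, fun a b y => ?_⟩
  simp only [runOps_append, hL₁, hL₂, hL₃, hL₄]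
  congr 1
  funext i r
  cases r with
  | new k =>
    by_cases h : k = c
    · subst h; simp [contents, Bool.xor_comm, Bool.and_comm]
    · simp [contents, h]
  | _ => simp [contents]

open Classical in
theorem adds_single_mem {a₀ : A} (ha : a₀ ≠ q) (c : Fin N) (T : Finset A) (hT : q ∉ T) :
    Adds e fun a b k => decide (k = c ∧ a = a₀ ∧ b ∈ T) := by
  induction T using Finset.induction_on with
  | empty => simpa using adds_false e
  | insert b₀ T hb ih =>
    rw [Finset.mem_insert, not_or] at hT
    have h := (ih hT.2).xor (adds_and e (e.symm ⟨a₀, ha⟩) (e.symm ⟨b₀, Ne.symm hT.1⟩) c)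
    simp only [code_symm] at h
    convert h using 4 with a b k
    by_cases h1 : k = c <;> by_cases h2 : a = a₀ <;> by_cases h3 : b = b₀ <;>
      simp [h1, h2, h3, hb]

open Classical in
theorem adds_mem_single {b₀ : A} (hb : b₀ ≠ q) (c : Fin N) (T : Finset A) (hT : q ∉ T) :
    Adds e fun a b k => decide (k = c ∧ a ∈ T ∧ b = b₀) := by
  induction T using Finset.induction_on with
  | empty => simpa using adds_false e
  | insert a₀ T ha ih =>
    rw [Finset.mem_insert, not_or] at hT
    have h := (ih hT.2).xor (adds_and e (e.symm ⟨a₀, Ne.symm hT.1⟩) (e.symm ⟨b₀, hb⟩) c)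
    simp only [code_symm] at h
    convert h using 4 with a b k
    by_cases h1 : k = c <;> by_cases h2 : a = a₀ <;> by_cases h3 : b = b₀ <;>
      simp [h1, h2, h3, ha]

open Classical in
-- The quiescent state has no bit of its own: its indicator is 1 plus the sum of all bits.
-- Multiplied by a bit of the other state, this has no constant term, which explains the exclusion
-- of the pair (q, q).
theorem adds_single [Finite A] (a₀ b₀ : A) (c : Fin N) (h : a₀ ≠ q ∨ b₀ ≠ q) :
    Adds e fun a b k => decide (k = c ∧ a = a₀ ∧ b = b₀) := by
  have := Fintype.ofFinite A
  by_cases ha : a₀ = q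
  · have hb : b₀ ≠ q := by tauto
    have h := (adds_cur e (e.symm ⟨b₀, hb⟩) c).xor
      (adds_mem_single e hb c (Finset.univ.erase q) (by simp))
    simp only [code_symm] at h
    convert h using 4 with a b k
    by_cases h1 : k = c <;> by_cases h2 : a = q <;> by_cases h3 : b = b₀ <;> simp [h1, h2, h3, ha]
  · by_cases hb : b₀ = q
    · have h := (adds_prev e (e.symm ⟨a₀, ha⟩) c).xor
        (adds_single_mem e ha c (Finset.univ.erase q) (by simp))
      simp only [code_symm] at h
      convert h using 4 with a b k
      by_cases h1 : k = c <;> by_cases h2 : a = a₀ <;> by_cases h3 : b = q <;>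
        simp [h1, h2, h3, hb]
    · simpa using adds_single_mem e ha c {b₀} (by simpa using Ne.symm hb)

open Classical in
-- `G` is the sum of the indicators of the points of its support, and the support avoids the pair
-- (q, q).
theorem adds_of_quiescent [Finite A] (G : A → A → Fin N → Bool) (hG : ∀ k, G q q k = false) :
    Adds e G := by
  have := Fintype.ofFinite A
  have key : ∀ S : Finset (A × A × Fin N), (∀ p ∈ S, p.1 ≠ q ∨ p.2.1 ≠ q) →
      Adds e fun a b k => decide ((a, b, k) ∈ S) := by
    intro S
    induction S using Finset.induction_on with
    | empty => intro _; simpa using adds_false e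
    | insert p S hp ih =>
      intro h
      obtain ⟨a₀, b₀, c⟩ := p
      have h := (ih fun p hp => h p (Finset.mem_insert_of_mem hp)).xor
        (adds_single e a₀ b₀ c (h _ (Finset.mem_insert_self _ _)))
      convert h using 4 with a b k
      by_cases h1 : (a, b, k) = (a₀, b₀, c)
      · simp only [Prod.mk.injEq] at h1
        obtain ⟨rfl, rfl, rfl⟩ := h1
        simp [hp]
      · have h2 : ¬ (k = c ∧ a = a₀ ∧ b = b₀) := by
          rintro ⟨rfl, rfl, rfl⟩
          exact h1 rfl
        simp only [Finset.mem_insert, or_iff_right h1, decide_eq_false h2, Bool.xor_false]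
  have h := key (Finset.univ.filter fun p => G p.1 p.2.1 p.2.2 = true) fun p hp => by
    by_contra! h'
    simp [h'.1, h'.2, hG] at hp
  simpa using h

/-- The row of bits that represents a configuration of the automaton. -/
noncomputable def encode (x : ℤ → A) : ℤ → Bool :=
  pack (contents (fun _ _ => false) (fun i => code e (x i)) (fun _ _ => false) fun _ => false)

theorem encode_column (x : ℤ → A) (i : ℤ) (k : Fin N) :
    encode e x (width N * i + (N + k)) = code e (x i) k :=
  pack_column _ i (.cur k)

theorem exists_of_encode {x : ℤ → A} {c : ℤ} (h : encode e x c = true) :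
    ∃ i, x i ≠ q ∧ width N * i ≤ c ∧ c < width N * (i + 1) := by
  obtain ⟨i, r, rfl⟩ | ⟨-, h'⟩ := column_or (N := N) c
  · have h1 := r.pos_nonneg
    have h2 := r.pos_lt
    refine ⟨i, fun hx => ?_, by omega, by rw [mul_add]; omega⟩
    rw [encode, pack_column] at h
    cases r <;> simp [contents, hx, code_quiescent] at h
  · rw [encode, h'] at h
    cases h

theorem exists_program [Finite A] (f : A → A → A) (hq : f q q = q) :
    ∃ L, L ≠ [] ∧ ∀ x : ℤ → A,
      runOps (width N) L (encode e x) = encode e (RadiusHalfCA.step f x) := by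
  obtain ⟨L₁, hL₁⟩ := exists_fetch_all (N := N) Finset.univ
  obtain ⟨L₂, hL₂⟩ := adds_of_quiescent e (fun a b => code e (f a b)) fun k => by
    rw [hq, code_quiescent]
  obtain ⟨L₃, hL₃⟩ := exists_finish (N := N) Finset.univ
  -- The idle operation makes the program nonempty even if all states are quiescent; otherwise the
  -- row shift could be 0.
  refine ⟨(0, .id) :: (L₁ ++ L₂ ++ L₃), List.cons_ne_nil _ _, fun x => ?_⟩
  have hid : ∀ row, runOps (width N) [(0, .id)] row = row := by
    intro row
    funext c
    simp [runOps, pairRow, Gate.apply]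
  rw [← List.singleton_append, runOps_append, hid, runOps_append, runOps_append, encode, hL₁]
  simp only [Finset.mem_univ, decide_true, Bool.true_and]
  rw [hL₂ (fun i => x (i - 1)) x, hL₃]
  simp [encode, RadiusHalfCA.step]

end Automaton

end Registers

/-! ## The simulation -/

theorem finite_initialStates {X v : ℤ → Bool} (hX : {e | X e = true}.Finite)
    (hv : {m | v m = true}.Finite) : {z | initialStates X v z = true}.Finite := by
  refine ((hX.image (dataCell 0)).union (hv.image (flagCell 0))).subset fun z hz => ?_
  simp only [initialStates, Set.mem_ofPred_eq, decide_eq_true_eq] at hz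
  rcases hz with ⟨e, rfl, he⟩ | ⟨m, rfl, hm⟩
  · exact Or.inl ⟨e, he, rfl⟩
  · exact Or.inr ⟨m, hm, rfl⟩

variable {A : Type*} {q : A} {N : ℕ} (e : Fin N ≃ {a : A // a ≠ q})

/-- The height of the part of the diagram that executes a program once. -/
def height (N : ℕ) (L : List (ℤ × Gate)) : ℕ := width N * L.length

/-- The places of the boxes that represent the configurations of the automaton. -/
noncomputable def layout {L : List (ℤ × Gate)} (hL : L ≠ []) : Layout A where
  bits := N
  code := code e
  code_injective := code_injective e
  -- `N + k` is the column of the register `cur k` in block 0.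
  offset k := dataCell 0 (N + k)
  cellShift := (16 * width N, 0)
  rowShift := (0, -24 * height N L)
  independent := by
    have := List.length_pos_iff.2 hL
    have h1 : (0 : ℤ) < width N := by simp only [width, halfWidth]; push_cast; omega
    have h2 : (0 : ℤ) < height N L := by simp only [height]; push_cast; positivity
    simp only [zero_mul, sub_zero]
    refine mul_ne_zero ?_ ?_ <;> omega
  distinct := by
    have := List.length_pos_iff.2 hL
    have h1 : (0 : ℤ) < width N := by simp only [width, halfWidth]; push_cast; omega
    have h2 : (0 : ℤ) < height N L := by simp only [height]; push_cast; positivity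
    rintro ⟨t, i, k⟩ ⟨t', i', k'⟩ h
    simp only [dataCell, Prod.smul_mk, Prod.mk_add_mk, smul_eq_mul, nsmul_eq_mul, Prod.mk.injEq,
      mul_zero, add_zero, zero_add] at h
    obtain ⟨h3, h4⟩ := h
    have h5 : (t : ℤ) = t' := mul_right_cancel₀ (b := -24 * (height N L : ℤ)) (by omega) h4
    have h6 := column_inj (i := i) (i' := i') (r := .cur k) (r' := .cur k')
      (by simp only [Reg.pos]; linarith)
    simp only [Reg.cur.injEq] at h6
    rw [Nat.cast_inj.1 h5, h6.1, h6.2]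

theorem layout_boxAt {L : List (ℤ × Gate)} (hL : L ≠ []) (t : ℕ) (i : ℤ) (k : Fin N) :
    (layout e hL).boxAt t i k =
      dataCell (height N L * t : ℕ) (width N * i + (N + k)) := by
  simp only [Layout.boxAt, layout, dataCell, Prod.smul_mk, Prod.mk_add_mk, smul_eq_mul,
    nsmul_eq_mul, Prod.mk.injEq]
  push_cast
  constructor <;> ring

theorem rows_encode [Finite A] {f : A → A → A} {L : List (ℤ × Gate)}
    (h : ∀ x : ℤ → A, runOps (width N) L (encode e x) = encode e (RadiusHalfCA.step f x))
    (x : ℤ → A) (t : ℕ) :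
    rows (halfWidth N) L (encode e x) (height N L * t) =
      encode e (RadiusHalfCA.evolve f t x) := by
  induction t with
  | zero => rfl
  | succ t ih =>
    have := rows_cycle (M := halfWidth N) (by simp [halfWidth]) L (encode e x) t
    change rows (halfWidth N) L (encode e x) (height N L * (t + 1)) =
      runOps (width N) L (rows (halfWidth N) L (encode e x) (height N L * t)) at this
    rw [this, ih, h, RadiusHalfCA.evolve, RadiusHalfCA.evolve, Function.iterate_succ_apply']

theorem exists_bounds {x : ℤ → A} (hx : RadiusHalfCA.IsFiniteConfig q x) :
    ∃ lo hi : ℤ, lo < hi ∧ ∀ c, encode e x c = true →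
      2 * (halfWidth N * lo) < c ∧ c ≤ 2 * (halfWidth N * hi) := by
  obtain ⟨a, ha⟩ := hx.bddBelow
  obtain ⟨b, hb⟩ := hx.bddAbove
  -- Comparing with 0 ensures `lo < hi` even for an empty support; the outer units give strictness
  -- on the left and contain the whole last block on the right.
  refine ⟨min a 0 - 1, max b 0 + 1, by omega, fun c hc => ?_⟩
  obtain ⟨i, hi, h1, h2⟩ := exists_of_encode e hc
  have h3 : a ≤ i := ha hi
  have h4 : i ≤ b := hb hi
  have hw : (0 : ℤ) < width N := by simp only [width, halfWidth]; push_cast; omega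
  have hw' : (width N : ℤ) = 2 * halfWidth N := by simp [width]
  rw [← mul_assoc, ← mul_assoc, ← hw']
  exact ⟨(mul_lt_mul_of_pos_left (by omega) hw).trans_le h1,
    h2.le.trans (mul_le_mul_of_nonneg_left (by omega) hw.le)⟩

end WiresBoxes

theorem theorem1 {A : Type*} [Finite A] (f : A → A → A) (q : A) (hq : f q q = q) :
    ∃ (D : WiresBoxes.Diagram) (L : WiresBoxes.Layout A),
      D.IsPeriod L.cellShift ∧ D.IsPeriod L.rowShift ∧
      ∀ x : ℤ → A, RadiusHalfCA.IsFiniteConfig q x →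
        ∃ (E : WiresBoxes.Diagram) (start : WiresBoxes.Port),
          E.IsFiniteModification D ∧ WiresBoxes.Simulates E start L f x := by
  open WiresBoxes in
  obtain ⟨N, ⟨e⟩⟩ := Finite.exists_equiv_fin {a : A // a ≠ q}
  obtain ⟨L, hL, hrun⟩ := exists_program e.symm f hq
  have hM : 2 ≤ halfWidth N := by simp [halfWidth]
  refine ⟨diagram (windows (halfWidth N) L) fun _ => false, layout e.symm hL, ?_, ?_,
    fun x hx => ?_⟩
  · have h := diagram_isPeriod (K := windows (halfWidth N) L) (a := 0) (b := halfWidth N)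
      fun s m => by rw [add_zero, windows_add_left]
    convert h using 1
    simp only [layout, width, Prod.mk.injEq]
    push_cast
    exact ⟨by ring, trivial⟩
  · have h := diagram_isPeriod (windows_add (M := halfWidth N) (by omega) L)
    convert h using 1
    simp only [layout, width, height, Prod.mk.injEq]
    push_cast
    constructor <;> ring
  · obtain ⟨lo, hi, hlt, hbd⟩ := exists_bounds e.symm hx
    obtain ⟨ρ, τ, h1, h2, h3, h4, h5⟩ :=
      (computes_windows hM L (encode e.symm x) hlt hbd).exists_run
    have hpos : 0 < height N L :=
      Nat.mul_pos (by simp [width, halfWidth]) (List.length_pos_iff.2 hL)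
    refine ⟨_, _, diagram_isFiniteModification _ (finite_initialStates ?_ ?_),
      -- One step of the automaton is one cycle of the program, that is, `height N L` layers.
      fun t i k => ?_, ρ, h1, h2, fun t => τ (height N L * t), by simpa using h3,
      fun t t' h => h4 (Nat.mul_lt_mul_of_pos_left h hpos), fun t n hn i k => ?_⟩
    · exact (Set.finite_Ioc _ _).subset fun c hc => hbd c hc
    · refine (Set.finite_Ioc (halfWidth N * (lo - 0)) (halfWidth N * hi)).subset fun m hm => ?_
      simp only [flags, Set.mem_ofPred_eq, decide_eq_true_eq] at hm
      exact hm.2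
    · rw [show (layout e.symm hL).boxAt t i k = _ from layout_boxAt e.symm hL t i k]
      exact ⟨_, _, diagram_dataCell _ _ _ _⟩
    · rw [show (layout e.symm hL).boxAt t i k = _ from layout_boxAt e.symm hL t i k,
        h5 _ _ _ hn, rows_encode e.symm hrun]
      exact encode_column e.symm _ i k
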